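/- Let $\sigma>0$. The \emph{$\psi$-transform} of a probability measure $\mu$ on the unit circle $\mathbb T$ is $\psi_\mu(z)=\int_{\mathbb T}\frac{uz}{1-uz}\,\mu(du)$, $|z|<1$; if $\int_{\mathbb T}u\,\mu(du)\ne 0$, then $\psi_\mu$ has an analytic local inverse $\psi_\mu^{-1}$ at $0$, and the \emph{$S$-transform} of $\mu$ is $S_\mu(w)=\frac{1+w}{w}\,\psi_\mu^{-1}(w)$ for small $w\neq 0$. The \emph{free unitary normal distribution} $\mathfrak N_{\sigma^2}$ is the probability measure on $\mathbb T$ with $\int_{\mathbb T} u\,\mathfrak N_{\sigma^2}(du)\neq0$ and $S_{\mathfrak N_{\sigma^2}}(w)=e^{\sigma^2(w+1/2)}$ for all small $w\ne0$. Let $t=\sigma^2/4$ and, for $\operatorname{Im}\theta>0$, let $\zeta_t(\theta)$ be the solution with $\operatorname{Im}\zeta>0$ of $\zeta-t\tan\zeta=\theta$; for real $\theta$ let $\zeta_t(\theta)$ be the limit of $\zeta_t(\eta)$ as $\eta\to\theta$, $\operatorname{Im}\eta>0$. \textbf{Theorem.} These objects are well defined: for $\operatorname{Im}\theta>0$ the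 equation has exactly one solution in the open upper half-plane, $\zeta_t$ is continuous on the closed upper half-plane, and there is exactly one probability measure $\mathfrak N_{\sigma^2}$ as above. The measure $\mathfrak N_{\sigma^2}$ has a continuous nonnegative density $f_{\sigma^2}$ with respect to the length measure (of total mass $2\pi$) on $\mathbb T$, given by $$f_{\sigma^2}(e^{i\theta})=\frac{2}{\pi\sigma^2}\operatorname{Im}\zeta_{\sigma^2/4}\!\left(\frac{\theta-\pi}{2}\right),\qquad \theta\in\mathbb R.$$ The measure $\mathfrak N_{\sigma^2}$ is invariant under complex conjugation, and $f_{\sigma^2}(e^{i\theta})=f_{\sigma^2}(e^{-i\theta})$ for all $\theta\in\mathbb R$. Moreover: (a) If $\sigma^2>4$, the function $\theta\mapsto f_{\sigma^2}(e^{i\theta})$ is strictly positive and real-analytic on $\mathbb R$. (b) If $0<\sigma^2<4$, put $$m_{\sigma^2}:=2\arcsin\frac\sigma2+\frac\sigma2\sqrt{4-\sigma^2}=\int_0^\sigma\sqrt{4-s^2}\,ds .$$ (The equality of the two expressions is part of the claim.) The function $\theta\mapsto f_{\sigma^2}(e^{i\theta})$ is continuous on $[-\pi,\pi]$, strictly positive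 and real-analytic on $(-m_{\sigma^2},m_{\sigma^2})$, and vanishes on $[-\pi,\pi]\setminus(-m_{\sigma^2},m_{\sigma^2})$. In particular it vanishes at $\pm m_{\sigma^2}$, where $$f_{\sigma^2}(e^{i(m_{\sigma^2}-\varepsilon)})=f_{\sigma^2}(e^{i(\varepsilon-m_{\sigma^2})})\sim\frac1{\pi\sigma^2}\sqrt[4]{\frac{4\sigma^2}{4-\sigma^2}}\,\sqrt\varepsilon,\qquad \varepsilon\downarrow0.$$ (c) If $\sigma^2=4$, the function $\theta\mapsto f_4(e^{i\theta})$ is strictly positive and real-analytic on $(-\pi,\pi)$. It vanishes at $\theta=\pm\pi$, where $$f_4(e^{i(\pi-\varepsilon)})=f_4(e^{i(\varepsilon-\pi)})\sim\frac{\sqrt3}{4\pi}\left(\frac{3\varepsilon}{2}\right)^{1/3},\qquad \varepsilon\downarrow0.$$ Here $\sim$ means that the ratio of the two sides tends to $1$. -/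

import Mathlib

open Set Filter Topology MeasureTheory Asymptotics

noncomputable section

namespace FreeUnitaryNormal

instance : MeasurableSpace Circle := borel Circle

instance : BorelSpace Circle := ⟨rfl⟩

/-- The `ψ`-transform `ψ_μ(z) = ∫ u z / (1 - u z) μ(du)` of a measure on the unit circle
(it is used for `z` near `0` only). -/
def psiTransform (μ : Measure Circle) (z : ℂ) : ℂ :=
  ∫ u : Circle, ((u : ℂ) * z) / (1 - (u : ℂ) * z) ∂μ

/-- `S` is the `S`-transform of `μ` near `0`: the first moment `ψ_μ'(0) = ∫ u μ(du)` does not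
vanish and `S(w) = (1 + w) / w * ψ_μ⁻¹(w)` for all small `w ≠ 0`, where `χ = ψ_μ⁻¹` is the
analytic local inverse of `ψ_μ` at `0`. -/
def HasSTransform (μ : Measure Circle) (S : ℂ → ℂ) : Prop :=
  (∫ u : Circle, (u : ℂ) ∂μ) ≠ 0 ∧
    ∃ χ : ℂ → ℂ, AnalyticAt ℂ χ 0 ∧ χ 0 = 0 ∧
      (∀ᶠ z in 𝓝 (0 : ℂ), χ (psiTransform μ z) = z) ∧
      (∀ᶠ w in 𝓝 (0 : ℂ), psiTransform μ (χ w) = w) ∧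
      ∀ᶠ w in 𝓝[≠] (0 : ℂ), S w = (1 + w) / w * χ w

/-- `μ` is the free unitary normal distribution with parameter `σ²`: a probability measure on the
unit circle whose `S`-transform is `exp (σ² (z + 1/2))`. -/
def IsFreeUnitaryNormal (σ : ℝ) (μ : Measure Circle) : Prop :=
  IsProbabilityMeasure μ ∧
    HasSTransform μ (fun z => Complex.exp ((σ : ℂ) ^ 2 * (z + 1 / 2)))

/-- The length measure (of total mass `2π`) on the unit circle. -/
def lengthMeasure : Measure Circle :=
  ((volume : Measure ℝ).restrict (Ioc (-Real.pi) Real.pi)).map Circle.exp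

/-- `ζ` is a solution in the open upper half-plane of `ζ - t tan ζ = θ`. -/
def IsZetaSolution (t : ℝ) (θ ζ : ℂ) : Prop :=
  0 < ζ.im ∧ ζ - (t : ℂ) * Complex.tan ζ = θ

/-- For `θ` in the open upper half-plane, the solution of `ζ - t tan ζ = θ` in the open upper
half-plane. -/
def zetaUpper (t : ℝ) (θ : ℂ) : ℂ :=
  Classical.epsilon (fun ζ : ℂ => IsZetaSolution t θ ζ)

/-- The function `ζ_t` on the closed upper half-plane: the solution of `ζ - t tan ζ = θ` in the
open half-plane, extended to real `θ` by its limit from the open upper half-plane. -/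
def zeta (t : ℝ) (θ : ℂ) : ℂ :=
  if 0 < θ.im then zetaUpper t θ else extendFrom {η : ℂ | 0 < η.im} (zetaUpper t) θ

/-- The half-length `m_{σ²} = 2 arcsin (σ/2) + (σ/2) √(4 - σ²)` of the arc. -/
def arcHalfLength (σ : ℝ) : ℝ :=
  2 * Real.arcsin (σ / 2) + σ / 2 * Real.sqrt (4 - σ ^ 2)

end FreeUnitaryNormal

end

/-! Conformal part. Write `F = tanMap t`. Since `Im F(ζ) |cos ζ|² = Im ζ (|cos ζ|² - t sinhc(2 Im
ζ))`, solutions above points of the upper half-plane lie in the closed set `tanDomain t`. There `F`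
is injective, by a strict Schwarz-Pick inequality for the tangent (`normSq_sin_sub_lt`), and proper,
because `F` moves points by at most `t + 1`. It is also open at non-real points. A connectedness
argument makes the image the whole closed half-plane (`image_tanMap`), so `ζ_t` is the inverse of a
closed embedding and is continuous up to the real line.

Measure part. With `z = -e^{2iθ}` put `H(z) = -i tan ζ_t(θ)`. The equation for `ζ_t` becomes `z (H +
1) = (H - 1) e^{2tH}`, which for `ψ = (H - 1)/2` and `4t = σ²` says exactly `χ(ψ(z)) = z`, with `χ`
the inverse prescribed by the `S`-transform. Moreover `H` is holomorphic in the disc, continuous on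
its closure, `H(0) = 1` and `Re H ≥ 0`. Hence `Re H / 2π` is the density of a probability measure,
whose `ψ`-transform is `(H - 1)/2` by Cauchy's formula (`psiTransform_normalMeasure`). Uniqueness
holds because `χ` determines `ψ` near `0`, hence all moments.

Shape of the density. On the circle `Re H = Im ζ_t / t`. It vanishes exactly at the values `y - t
tan y` with `y` real and `cos² y ≥ t`, and is analytic elsewhere because `F' ≠ 0` at non-real points
of `tanDomain t`. For `t < 1` the arc ends at critical values of `F`, where a double point gives the
square root. For `t = 1` the two critical points merge into a triple point at `0`, which gives the
cube root. -/

noncomputable section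

namespace FreeUnitaryNormal

/-! ### The hyperbolic cardinal sine -/

/-- The continuous extension of `sinh y / y`. -/
def sinhc (y : ℝ) : ℝ := dslope Real.sinh 0 y

lemma mul_sinhc (y : ℝ) : y * sinhc y = Real.sinh y := by
  simpa [sinhc] using sub_smul_dslope Real.sinh 0 y

@[simp] lemma sinhc_zero : sinhc 0 = 1 := by
  simp [sinhc]

lemma continuous_sinhc : Continuous sinhc := by
  have h := (continuousOn_dslope (f := Real.sinh) (a := 0) (s := univ) univ_mem).2
    ⟨Real.continuous_sinh.continuousOn, Real.differentiable_sinh 0⟩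
  exact continuousOn_univ.1 h

lemma one_lt_sinhc {y : ℝ} (hy : 0 < y) : 1 < sinhc y := by
  have h := Real.self_lt_sinh_iff.2 hy
  rw [← mul_sinhc] at h
  nlinarith

lemma one_le_sinhc {y : ℝ} (hy : 0 ≤ y) : 1 ≤ sinhc y := by
  rcases hy.eq_or_lt with rfl | h
  · simp
  · exact (one_lt_sinhc h).le

lemma sinh_lt_mul_cosh {y : ℝ} (hy : 0 < y) : Real.sinh y < y * Real.cosh y := by
  have hmono : StrictMonoOn (fun y : ℝ => y * Real.cosh y - Real.sinh y) (Ici 0) := by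
    apply strictMonoOn_of_deriv_pos (convex_Ici 0)
    · fun_prop
    · intro x hx
      rw [interior_Ici] at hx
      have : HasDerivAt (fun y : ℝ => y * Real.cosh y - Real.sinh y)
          (1 * Real.cosh x + x * Real.sinh x - Real.cosh x) x :=
        ((hasDerivAt_id x).mul (Real.hasDerivAt_cosh x)).sub (Real.hasDerivAt_sinh x)
      rw [this.deriv]
      have := Real.sinh_pos_iff.2 hx
      have hx' : (0 : ℝ) < x := hx
      nlinarith [mul_pos hx' this]
  have := hmono self_mem_Ici hy.le hy
  simp at this
  linarith

lemma sinh_le_mul_cosh {y : ℝ} (hy : 0 ≤ y) : Real.sinh y ≤ y * Real.cosh y := by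
  rcases hy.eq_or_lt with rfl | h
  · simp
  · exact (sinh_lt_mul_cosh h).le

/-- Expand `sinh (v + d)` and use `sinh d ≤ d cosh d`, `v ≤ sinh v` and `1 ≤ cosh v`. -/
lemma sinhc_le_sinhc_add {v d : ℝ} (hv : 0 ≤ v) (hd : 0 < d) : sinhc d ≤ sinhc (v + d) := by
  have h1 : d * sinhc d = Real.sinh d := mul_sinhc d
  have h2 : (v + d) * sinhc (v + d) = Real.sinh (v + d) := mul_sinhc _
  rw [Real.sinh_add] at h2
  have h3 := sinh_le_mul_cosh hd.le
  have h4 : v ≤ Real.sinh v := Real.self_le_sinh_iff.2 hv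
  have h5 := Real.one_le_cosh v
  have h6 := Real.sinh_pos_iff.2 hd
  have h7 := Real.cosh_pos d
  have h8 : (v + d) * Real.sinh d ≤ d * ((v + d) * sinhc (v + d)) := by
    rw [h2]
    nlinarith [mul_le_mul_of_nonneg_left h3 hv, mul_nonneg (mul_pos hd h7).le (sub_nonneg.2 h4),
      mul_nonneg (mul_pos hd h6).le (sub_nonneg.2 h5)]
  rw [← h1] at h8
  have h9 : 0 < (v + d) * d := by positivity
  nlinarith

/-- With `d = u - v`, the chain is `sinhc d ^ 2 < sinhc d * cosh d = sinhc (2d) ≤ sinhc (2u)`, and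
the factor `sinhc (2v)` is at least `1`. -/
lemma sq_sinhc_lt {u v : ℝ} (hv : 0 ≤ v) (huv : v < u) :
    sinhc (u - v) ^ 2 < sinhc (2 * u) * sinhc (2 * v) := by
  have hd : 0 < u - v := sub_pos.2 huv
  set d := u - v with hd'
  have h1 : sinhc (2 * d) ≤ sinhc (2 * u) := by
    have := sinhc_le_sinhc_add (v := 2 * v) (d := 2 * d) (by positivity) (by positivity)
    rwa [show 2 * v + 2 * d = 2 * u by rw [hd']; ring] at this
  have h2 : 1 ≤ sinhc (2 * v) := one_le_sinhc (by positivity)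
  have h3 := mul_sinhc d
  have h4 := mul_sinhc (2 * d)
  rw [Real.sinh_two_mul] at h4
  have h5 := sinh_lt_mul_cosh hd
  have h6 : 1 ≤ sinhc d := one_le_sinhc hd.le
  have h7 : sinhc (2 * d) = sinhc d * Real.cosh d := by
    rw [← h3] at h4
    have : d * (sinhc (2 * d) - sinhc d * Real.cosh d) = 0 := by linarith
    rcases mul_eq_zero.1 this with h | h
    · exact absurd h hd.ne'
    · linarith
  have h8 : sinhc d < Real.cosh d := by
    rw [← h3] at h5
    exact lt_of_mul_lt_mul_left h5 hd.le
  calc sinhc d ^ 2 < sinhc d * Real.cosh d := by nlinarith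
    _ = sinhc (2 * d) := h7.symm
    _ ≤ sinhc (2 * u) := h1
    _ ≤ sinhc (2 * u) * sinhc (2 * v) := by
      have : 1 ≤ sinhc (2 * u) := one_le_sinhc (by linarith)
      nlinarith

/-! ### A strict Schwarz-Pick inequality for the tangent -/

lemma normSq_sin (ζ : ℂ) :
    Complex.normSq (Complex.sin ζ) = Real.sin ζ.re ^ 2 + Real.sinh ζ.im ^ 2 := by
  rw [Complex.sin_eq, Complex.normSq_apply]
  simp only [← Complex.ofReal_sin, ← Complex.ofReal_cos, ← Complex.ofReal_sinh,
    ← Complex.ofReal_cosh, ← Complex.ofReal_mul, Complex.add_re, Complex.add_im,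
    Complex.ofReal_re, Complex.ofReal_im, Complex.mul_re, Complex.mul_im,
    Complex.I_re, Complex.I_im]
  have h1 := Real.sin_sq_add_cos_sq ζ.re
  have h2 := Real.cosh_sq ζ.im
  linear_combination Real.sin ζ.re ^ 2 * h2 + Real.sinh ζ.im ^ 2 * h1

/-- A strict form of the Schwarz-Pick inequality for the tangent on the closed half-plane. -/
lemma normSq_sin_sub_lt_of_le {a b : ℂ} (hab : a ≠ b) (hb : 0 ≤ b.im) (h : b.im ≤ a.im) :
    Complex.normSq (Complex.sin (a - b)) <
      Complex.normSq (a - b) * (sinhc (2 * a.im) * sinhc (2 * b.im)) := by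
  have hs : Complex.normSq (Complex.sin (a - b)) =
      Real.sin (a.re - b.re) ^ 2 + Real.sinh (a.im - b.im) ^ 2 := by
    rw [normSq_sin, Complex.sub_re, Complex.sub_im]
  have hn : Complex.normSq (a - b) = (a.re - b.re) ^ 2 + (a.im - b.im) ^ 2 := by
    simp [Complex.normSq_apply]; ring
  rw [hs, hn, ← mul_sinhc]
  have hx : Real.sin (a.re - b.re) ^ 2 ≤ (a.re - b.re) ^ 2 := sq_le_sq.2 Real.abs_sin_le_abs
  have hA : 1 ≤ sinhc (2 * a.im) := one_le_sinhc (by linarith)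
  have hB : 1 ≤ sinhc (2 * b.im) := one_le_sinhc (by linarith)
  have hAB : 1 ≤ sinhc (2 * a.im) * sinhc (2 * b.im) := by nlinarith
  have hx2 : (a.re - b.re) ^ 2 ≤ (a.re - b.re) ^ 2 * (sinhc (2 * a.im) * sinhc (2 * b.im)) :=
    le_mul_of_one_le_right (sq_nonneg _) hAB
  -- Strictness comes from `|sin x| < |x|` when the imaginary parts agree, and from `sq_sinhc_lt`
  -- otherwise.
  rcases h.eq_or_lt with h0 | h0
  · have hne : a.re - b.re ≠ 0 := fun h1 => hab (Complex.ext (by linarith) h0.symm)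
    have : Real.sin (a.re - b.re) ^ 2 < (a.re - b.re) ^ 2 :=
      sq_lt_sq.2 (Real.abs_sin_lt_abs hne)
    rw [← h0] at hAB hx2 ⊢
    simp only [sub_self, zero_mul]
    nlinarith
  · have := sq_sinhc_lt hb h0
    have hd : 0 < (a.im - b.im) ^ 2 := by
      have := sub_pos.2 h0
      positivity
    nlinarith [mul_lt_mul_of_pos_left this hd]

lemma normSq_sin_sub_lt {a b : ℂ} (hab : a ≠ b) (ha : 0 ≤ a.im) (hb : 0 ≤ b.im) :
    Complex.normSq (Complex.sin (a - b)) <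
      Complex.normSq (a - b) * (sinhc (2 * a.im) * sinhc (2 * b.im)) := by
  rcases le_total b.im a.im with h | h
  · exact normSq_sin_sub_lt_of_le hab hb h
  · have := normSq_sin_sub_lt_of_le hab.symm ha h
    rwa [← neg_sub, Complex.sin_neg, Complex.normSq_neg, Complex.normSq_neg,
      mul_comm (sinhc _)] at this

/-! ### The map `ζ ↦ ζ - t tan ζ` -/

/-- The map whose right inverse is `ζ_t`. -/
def tanMap (t : ℝ) (ζ : ℂ) : ℂ := ζ - t * Complex.tan ζ

/-- The closure of the image of the upper half-plane under `ζ_t`. -/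
def tanDomain (t : ℝ) : Set ℂ :=
  {ζ | 0 ≤ ζ.im ∧ t * sinhc (2 * ζ.im) ≤ Complex.normSq (Complex.cos ζ)}

lemma normSq_cos (ζ : ℂ) :
    Complex.normSq (Complex.cos ζ) = Real.cos ζ.re ^ 2 + Real.sinh ζ.im ^ 2 := by
  rw [Complex.cos_eq, Complex.normSq_apply]
  simp only [← Complex.ofReal_sin, ← Complex.ofReal_cos, ← Complex.ofReal_sinh,
    ← Complex.ofReal_cosh, ← Complex.ofReal_mul, Complex.sub_re, Complex.sub_im,
    Complex.ofReal_re, Complex.ofReal_im, Complex.mul_re, Complex.mul_im,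
    Complex.I_re, Complex.I_im]
  have h1 := Real.sin_sq_add_cos_sq ζ.re
  have h2 := Real.cosh_sq ζ.im
  linear_combination Real.cos ζ.re ^ 2 * h2 + Real.sinh ζ.im ^ 2 * h1

lemma im_tan_mul_normSq_cos {ζ : ℂ} (h : Complex.cos ζ ≠ 0) :
    (Complex.tan ζ).im * Complex.normSq (Complex.cos ζ) = ζ.im * sinhc (2 * ζ.im) := by
  have h0 : Complex.normSq (Complex.cos ζ) ≠ 0 := by simpa using h
  have hs : ζ.im * sinhc (2 * ζ.im) = Real.sinh ζ.im * Real.cosh ζ.im := by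
    have := mul_sinhc (2 * ζ.im)
    rw [Real.sinh_two_mul] at this
    linarith
  rw [hs, Complex.tan_eq_sin_div_cos, Complex.div_im]
  field_simp
  rw [Complex.sin_eq ζ, Complex.cos_eq ζ]
  simp only [← Complex.ofReal_sin, ← Complex.ofReal_cos, ← Complex.ofReal_sinh,
    ← Complex.ofReal_cosh, ← Complex.ofReal_mul, Complex.add_re, Complex.add_im, Complex.sub_re,
    Complex.sub_im, Complex.ofReal_re, Complex.ofReal_im, Complex.mul_re, Complex.mul_im,
    Complex.I_re, Complex.I_im]
  have h1 := Real.sin_sq_add_cos_sq ζ.re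
  linear_combination Real.sinh ζ.im * Real.cosh ζ.im * h1

lemma cos_ne_zero_of_im_pos {ζ : ℂ} (h : 0 < ζ.im) : Complex.cos ζ ≠ 0 := by
  rw [← Complex.normSq_pos, normSq_cos]
  have := Real.sinh_pos_iff.2 h
  positivity

/-- Factoring out `Im ζ` by means of `sinhc` leaves a condition that still has content on the real
axis, where it reads `t ≤ cos² ζ`. This is why `tanDomain` is defined by the second factor. -/
lemma im_tanMap_mul {t : ℝ} {ζ : ℂ} (h : Complex.cos ζ ≠ 0) :
    (tanMap t ζ).im * Complex.normSq (Complex.cos ζ) =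
      ζ.im * (Complex.normSq (Complex.cos ζ) - t * sinhc (2 * ζ.im)) := by
  have := im_tan_mul_normSq_cos h
  simp only [tanMap, Complex.sub_im, Complex.im_ofReal_mul]
  linear_combination -t * this

section

variable {t : ℝ} {ζ : ℂ}

lemma mem_tanDomain_of_im_pos (h : 0 < ζ.im) (hF : 0 ≤ (tanMap t ζ).im) : ζ ∈ tanDomain t := by
  have h0 := cos_ne_zero_of_im_pos h
  have h1 := im_tanMap_mul (t := t) h0
  have h2 : 0 < Complex.normSq (Complex.cos ζ) := Complex.normSq_pos.2 h0
  refine ⟨h.le, ?_⟩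
  have : 0 ≤ ζ.im * (Complex.normSq (Complex.cos ζ) - t * sinhc (2 * ζ.im)) := by
    rw [← h1]; positivity
  linarith [nonneg_of_mul_nonneg_right this h]

variable (ht : 0 < t)
include ht

lemma le_normSq_cos (h : ζ ∈ tanDomain t) : t ≤ Complex.normSq (Complex.cos ζ) := by
  have h1 : 1 ≤ sinhc (2 * ζ.im) := one_le_sinhc (by linarith [h.1])
  nlinarith [h.2]

lemma cos_ne_zero (h : ζ ∈ tanDomain t) : Complex.cos ζ ≠ 0 := by
  rw [← Complex.normSq_pos]
  exact ht.trans_le (le_normSq_cos ht h)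

lemma im_tanMap_nonneg (h : ζ ∈ tanDomain t) : 0 ≤ (tanMap t ζ).im := by
  have h0 := cos_ne_zero ht h
  have h1 := im_tanMap_mul (t := t) h0
  have h2 : 0 < Complex.normSq (Complex.cos ζ) := Complex.normSq_pos.2 h0
  have : 0 ≤ (tanMap t ζ).im * Complex.normSq (Complex.cos ζ) := by
    rw [h1]; exact mul_nonneg h.1 (sub_nonneg.2 h.2)
  exact nonneg_of_mul_nonneg_left this h2

lemma im_tanMap_le (h : ζ ∈ tanDomain t) : (tanMap t ζ).im ≤ ζ.im := by
  have h0 := cos_ne_zero ht h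
  have h1 := im_tanMap_mul (t := t) h0
  have h2 : 0 < Complex.normSq (Complex.cos ζ) := Complex.normSq_pos.2 h0
  have h3 : 1 ≤ sinhc (2 * ζ.im) := one_le_sinhc (by linarith [h.1])
  have h4 : 0 ≤ ζ.im * (t * sinhc (2 * ζ.im)) := mul_nonneg h.1 (by positivity)
  nlinarith

lemma norm_tan_le (h : ζ ∈ tanDomain t) : ‖Complex.tan ζ‖ ≤ 1 + 1 / t := by
  have h0 := cos_ne_zero ht h
  have h1 := le_normSq_cos ht h
  have h2 : 0 < Complex.normSq (Complex.cos ζ) := Complex.normSq_pos.2 h0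
  have h3 : Complex.normSq (Complex.tan ζ) ≤ 1 + 1 / t := by
    rw [Complex.tan_eq_sin_div_cos, map_div₀, div_le_iff₀ h2]
    have h4 : Complex.normSq (Complex.sin ζ) ≤ Complex.normSq (Complex.cos ζ) + 1 := by
      rw [normSq_sin, normSq_cos]
      nlinarith [Real.sin_sq_add_cos_sq ζ.re, sq_nonneg (Real.cos ζ.re)]
    have h5 : 1 ≤ 1 / t * Complex.normSq (Complex.cos ζ) := by
      rw [one_div, inv_mul_eq_div, one_le_div ht]; exact h1
    linarith
  rw [Complex.normSq_eq_norm_sq] at h3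
  have : 0 < 1 / t := by positivity
  nlinarith [norm_nonneg (Complex.tan ζ)]

/-- Bounded displacement is the source of properness. -/
lemma norm_sub_tanMap_le (h : ζ ∈ tanDomain t) : ‖ζ - tanMap t ζ‖ ≤ t + 1 := by
  rw [tanMap, sub_sub_cancel, norm_mul, Complex.norm_real, Real.norm_of_nonneg ht.le]
  calc t * ‖Complex.tan ζ‖ ≤ t * (1 + 1 / t) := by gcongr; exact norm_tan_le ht h
    _ = t + 1 := by field_simp

lemma hasStrictDerivAt_tanMap (h : ζ ∈ tanDomain t) :
    HasStrictDerivAt (tanMap t) (1 - t * (1 / Complex.cos ζ ^ 2)) ζ :=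
  (hasStrictDerivAt_id ζ).sub ((Complex.hasStrictDerivAt_tan (cos_ne_zero ht h)).const_mul _)

lemma continuousOn_tanMap : ContinuousOn (tanMap t) (tanDomain t) := fun _ h =>
  (hasStrictDerivAt_tanMap ht h).hasDerivAt.continuousAt.continuousWithinAt

lemma analyticAt_tanMap (h : ζ ∈ tanDomain t) : AnalyticAt ℂ (tanMap t) ζ := by
  have h0 := cos_ne_zero ht h
  have : AnalyticAt ℂ (fun ζ => ζ - t * (Complex.sin ζ / Complex.cos ζ)) ζ := by
    fun_prop (disch := assumption)
  exact this

/-- A critical point has `|cos ζ|² = t`, but off the real axis `sinhc (2 Im ζ) > 1` and membership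
forces `|cos ζ|² > t`. -/
lemma deriv_tanMap_ne_zero (h : ζ ∈ tanDomain t) (hpos : 0 < ζ.im) :
    1 - (t : ℂ) * (1 / Complex.cos ζ ^ 2) ≠ 0 := by
  have h0 := cos_ne_zero ht h
  intro hz
  have h1 : Complex.cos ζ ^ 2 = t := by
    field_simp at hz
    linear_combination hz
  have h2 : Complex.normSq (Complex.cos ζ) = t := by
    rw [Complex.normSq_eq_norm_sq, ← norm_pow, h1, Complex.norm_real, Real.norm_of_nonneg ht.le]
  have h3 : 1 < sinhc (2 * ζ.im) := one_lt_sinhc (by linarith)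
  have := h.2
  nlinarith

/-- Equal values at `a` and `b` give `(a - b) cos a cos b = t sin (a - b)`. Bounding the cosines
below by the definition of `tanDomain` contradicts `normSq_sin_sub_lt`. -/
lemma injOn_tanMap : InjOn (tanMap t) (tanDomain t) := by
  intro a ha b hb hab
  by_contra hne
  have hca := cos_ne_zero ht ha
  have hcb := cos_ne_zero ht hb
  have h1 : (a - b) * (Complex.cos a * Complex.cos b) = t * Complex.sin (a - b) := by
    simp only [tanMap, Complex.tan_eq_sin_div_cos] at hab
    rw [Complex.sin_sub]
    field_simp at hab
    linear_combination hab
  have h2 := congrArg Complex.normSq h1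
  simp only [map_mul, Complex.normSq_ofReal] at h2
  have h3 := normSq_sin_sub_lt hne ha.1 hb.1
  have h4 : (t * sinhc (2 * a.im)) * (t * sinhc (2 * b.im)) ≤
      Complex.normSq (Complex.cos a) * Complex.normSq (Complex.cos b) := by
    have := one_le_sinhc (y := 2 * b.im) (by linarith [hb.1])
    exact mul_le_mul ha.2 hb.2 (by positivity) (Complex.normSq_nonneg _)
  have h5 := mul_le_mul_of_nonneg_left h4 (Complex.normSq_nonneg (a - b))
  nlinarith [mul_pos ht ht, mul_lt_mul_of_pos_left h3 (mul_pos ht ht)]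

omit ht in
lemma isClosed_tanDomain : IsClosed (tanDomain t) := by
  have h1 : Continuous fun ζ : ℂ => t * sinhc (2 * ζ.im) :=
    continuous_const.mul (continuous_sinhc.comp (continuous_const.mul Complex.continuous_im))
  have h2 : Continuous fun ζ : ℂ => Complex.normSq (Complex.cos ζ) :=
    Complex.continuous_normSq.comp Complex.continuous_cos
  exact (isClosed_le continuous_const Complex.continuous_im).and (isClosed_le h1 h2)

/-- `tanMap t` is proper on `tanDomain t`. -/
lemma isClosedEmbedding_tanMap :
    IsClosedEmbedding (fun ζ : tanDomain t => tanMap t ζ) := by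
  have hc : Continuous (fun ζ : tanDomain t => tanMap t ζ) :=
    continuousOn_iff_continuous_domRestrict.1 (continuousOn_tanMap ht)
  refine .of_continuous_injective_isClosedMap hc (fun a b h => Subtype.ext (injOn_tanMap ht a.2 b.2 h)) ?_
  have hp : IsProperMap (fun ζ : tanDomain t => tanMap t ζ) := by
    rw [isProperMap_iff_isCompact_preimage]
    refine ⟨hc, fun K hK => ?_⟩
    rw [(isClosed_tanDomain (t := t)).isClosedEmbedding_subtypeVal.isCompact_iff]
    obtain ⟨R, hR⟩ := hK.isBounded.exists_norm_le
    refine (isCompact_closedBall (0 : ℂ) (R + (t + 1))).of_isClosed_subset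
      ((isClosed_tanDomain (t := t)).isClosedEmbedding_subtypeVal.isClosedMap _
        (hK.isClosed.preimage hc)) ?_
    rintro _ ⟨ζ, hζ, rfl⟩
    rw [mem_closedBall_zero_iff]
    have h1 := norm_sub_tanMap_le ht ζ.2
    have h2 := hR _ hζ
    calc ‖(ζ : ℂ)‖ = ‖tanMap t ζ + (ζ - tanMap t ζ)‖ := by congr 1; ring
      _ ≤ _ := (norm_add_le _ _).trans (add_le_add h2 h1)
  exact hp.isClosedMap

lemma tanMap_nhds (h : ζ ∈ tanDomain t) (hpos : 0 < ζ.im) :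
    map (tanMap t) (𝓝 ζ) = 𝓝 (tanMap t ζ) :=
  (hasStrictDerivAt_tanMap ht h).map_nhds_eq (deriv_tanMap_ne_zero ht h hpos)

/-- Inside the open half-plane the image is nonempty, open (the derivative does not vanish) and
relatively closed (closed embedding), hence everything; taking closures adds the real line. -/
lemma image_tanMap : tanMap t '' tanDomain t = {θ | 0 ≤ θ.im} := by
  have hcl : IsClosed (tanMap t '' tanDomain t) := by
    have := (isClosedEmbedding_tanMap ht).isClosed_range
    rwa [image_eq_range]
  apply Subset.antisymm
  · rintro _ ⟨ζ, hζ, rfl⟩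
    exact im_tanMap_nonneg ht hζ
  set U : Set ℂ := {θ | 0 < θ.im} with hU
  have hUo : IsOpen U := isOpen_lt continuous_const Complex.continuous_im
  have hUcl : closure U = {θ | 0 ≤ θ.im} := Complex.closure_setOfPred_lt_im 0
  rw [← hUcl]
  refine closure_minimal ?_ hcl
  have hpre : IsPreconnected U := (convex_halfSpace_im_gt 0).isPreconnected
  suffices h : U ⊆ U ∩ tanMap t '' tanDomain t from h.trans inter_subset_right
  refine hpre.subset_of_closure_inter_subset (u := U ∩ tanMap t '' tanDomain t) ?_ ?_ ?_
  · rw [isOpen_iff_mem_nhds]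
    rintro _ ⟨hθ, ζ, hζ, rfl⟩
    have hpos : 0 < ζ.im := lt_of_lt_of_le hθ (im_tanMap_le ht hζ)
    have h1 : ∀ᶠ z in 𝓝 ζ, tanMap t z ∈ U ∩ tanMap t '' tanDomain t := by
      have hc := (hasStrictDerivAt_tanMap ht hζ).hasDerivAt.continuousAt
      filter_upwards [hc (hUo.mem_nhds hθ),
        (isOpen_lt continuous_const Complex.continuous_im).mem_nhds hpos] with z hz hz'
      exact ⟨hz, z, mem_tanDomain_of_im_pos hz' (le_of_lt hz), rfl⟩
    rw [← tanMap_nhds ht hζ hpos]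
    exact h1
  -- At `s i` with `s = t + 1`, positivity of the imaginary part amounts to `s cosh² s > t sinh s
  -- cosh s`.
  · have hpos : 0 < (((t + 1 : ℝ) : ℂ) * Complex.I).im := by simp; positivity
    have h0 := cos_ne_zero_of_im_pos hpos
    have h1 := im_tanMap_mul (t := t) h0
    have h2 : (tanMap t (((t + 1 : ℝ) : ℂ) * Complex.I)).im ∈ Ioi 0 := by
      have h3 := mul_sinhc (2 * (t + 1))
      rw [Real.sinh_two_mul] at h3
      rw [normSq_cos] at h1
      simp only [Complex.im_ofReal_mul, Complex.re_ofReal_mul, Complex.I_re, Complex.I_im, mul_zero,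
        mul_one, Real.cos_zero] at h1
      have h4 := Real.cosh_sq (t + 1)
      have h5 := Real.sinh_lt_cosh (t + 1)
      have h6 := Real.cosh_pos (t + 1)
      refine pos_of_mul_pos_left (b := 1 ^ 2 + Real.sinh (t + 1) ^ 2) ?_ (by positivity)
      rw [h1]
      nlinarith [mul_pos ht (mul_pos h6 (sub_pos.2 h5)), mul_pos h6 h6]
    exact ⟨_, h2, h2, _, mem_tanDomain_of_im_pos hpos (le_of_lt h2), rfl⟩
  · rintro θ ⟨hθ, hθU⟩
    exact ⟨hθU, closure_minimal inter_subset_right hcl hθ⟩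

end

/-! ### The function `ζ_t` on the closed upper half-plane -/

section

variable {t : ℝ} (ht : 0 < t)
include ht

lemma isZetaSolution_iff {θ ζ : ℂ} (hθ : 0 < θ.im) :
    IsZetaSolution t θ ζ ↔ ζ ∈ tanDomain t ∧ tanMap t ζ = θ := by
  constructor
  · rintro ⟨h1, h2⟩
    have h3 : tanMap t ζ = θ := h2
    exact ⟨mem_tanDomain_of_im_pos h1 (by rw [h3]; exact hθ.le), h3⟩
  · rintro ⟨h1, rfl⟩
    exact ⟨hθ.trans_le (im_tanMap_le ht h1), rfl⟩

lemma exists_tanMap_eq {θ : ℂ} (hθ : 0 ≤ θ.im) : ∃ ζ ∈ tanDomain t, tanMap t ζ = θ := by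
  have : θ ∈ tanMap t '' tanDomain t := by rw [image_tanMap ht]; exact hθ
  exact this

lemma existsUnique_isZetaSolution {θ : ℂ} (hθ : 0 < θ.im) : ∃! ζ, IsZetaSolution t θ ζ := by
  obtain ⟨ζ, h1, h2⟩ := exists_tanMap_eq ht hθ.le
  refine ⟨ζ, (isZetaSolution_iff ht hθ).2 ⟨h1, h2⟩, fun ζ' h' => ?_⟩
  have h3 := (isZetaSolution_iff ht hθ).1 h'
  exact injOn_tanMap ht h3.1 h1 (h3.2.trans h2.symm)

lemma continuousOn_invFunOn_tanMap :
    ContinuousOn (Function.invFunOn (tanMap t) (tanDomain t)) {θ : ℂ | 0 ≤ θ.im} := by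
  have key : ∀ θ : {θ : ℂ | 0 ≤ θ.im},
      Function.invFunOn (tanMap t) (tanDomain t) (θ : ℂ) ∈ tanDomain t ∧
      tanMap t (Function.invFunOn (tanMap t) (tanDomain t) (θ : ℂ)) = θ :=
    fun θ => ⟨Function.invFunOn_mem (exists_tanMap_eq ht θ.2),
      Function.invFunOn_eq (exists_tanMap_eq ht θ.2)⟩
  have h1 : Continuous fun θ : {θ : ℂ | 0 ≤ θ.im} =>
      (⟨Function.invFunOn (tanMap t) (tanDomain t) (θ : ℂ), (key θ).1⟩ : tanDomain t) := by
    rw [(isClosedEmbedding_tanMap ht).isInducing.continuous_iff]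
    have : ((fun ζ : tanDomain t => tanMap t ζ) ∘ fun θ : {θ : ℂ | 0 ≤ θ.im} =>
      (⟨Function.invFunOn (tanMap t) (tanDomain t) (θ : ℂ), (key θ).1⟩ : tanDomain t)) =
        Subtype.val := funext fun θ => (key θ).2
    rw [this]
    exact continuous_subtype_val
  exact continuousOn_iff_continuous_domRestrict.2 (continuous_subtype_val.comp h1)

lemma zetaUpper_eq_invFunOn {θ : ℂ} (hθ : 0 < θ.im) :
    zetaUpper t θ = Function.invFunOn (tanMap t) (tanDomain t) θ := by
  have h1 : IsZetaSolution t θ (zetaUpper t θ) :=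
    Classical.epsilon_spec (existsUnique_isZetaSolution ht hθ).exists
  refine (existsUnique_isZetaSolution ht hθ).unique h1 ((isZetaSolution_iff ht hθ).2 ?_)
  exact ⟨Function.invFunOn_mem (exists_tanMap_eq ht hθ.le),
    Function.invFunOn_eq (exists_tanMap_eq ht hθ.le)⟩

/-- The inverse on the closed half-plane is already continuous, so the limit defining `zeta` at real
points exists and equals it. -/
lemma zeta_eq_invFunOn {θ : ℂ} (hθ : 0 ≤ θ.im) :
    zeta t θ = Function.invFunOn (tanMap t) (tanDomain t) θ := by
  unfold zeta
  split_ifs with h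
  · exact zetaUpper_eq_invFunOn ht h
  · refine extendFrom_eq ?_ ?_
    · rw [Complex.closure_setOfPred_lt_im]; exact hθ
    · have h1 := (continuousOn_invFunOn_tanMap ht θ hθ).mono_left
        (nhdsWithin_mono θ (fun η (hη : 0 < η.im) => hη.le : {η : ℂ | 0 < η.im} ⊆ _))
      refine h1.congr' ?_
      filter_upwards [self_mem_nhdsWithin] with η hη
      exact (zetaUpper_eq_invFunOn ht hη).symm

lemma continuousOn_zeta : ContinuousOn (zeta t) {θ : ℂ | 0 ≤ θ.im} :=
  (continuousOn_invFunOn_tanMap ht).congr fun _ hθ => zeta_eq_invFunOn ht hθ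

lemma zeta_mem {θ : ℂ} (hθ : 0 ≤ θ.im) : zeta t θ ∈ tanDomain t := by
  rw [zeta_eq_invFunOn ht hθ]
  exact Function.invFunOn_mem (exists_tanMap_eq ht hθ)

lemma tanMap_zeta {θ : ℂ} (hθ : 0 ≤ θ.im) : tanMap t (zeta t θ) = θ := by
  rw [zeta_eq_invFunOn ht hθ]
  exact Function.invFunOn_eq (exists_tanMap_eq ht hθ)

lemma eq_zeta {ζ θ : ℂ} (hζ : ζ ∈ tanDomain t) (h : tanMap t ζ = θ) : ζ = zeta t θ := by
  have hθ : 0 ≤ θ.im := h ▸ im_tanMap_nonneg ht hζ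
  exact injOn_tanMap ht hζ (zeta_mem ht hθ) (h.trans (tanMap_zeta ht hθ).symm)

lemma im_zeta_pos {θ : ℂ} (hθ : 0 < θ.im) : 0 < (zeta t θ).im := by
  have := im_tanMap_le ht (zeta_mem ht hθ.le)
  rw [tanMap_zeta ht hθ.le] at this
  exact hθ.trans_le this

lemma isZetaSolution_zeta {θ : ℂ} (hθ : 0 < θ.im) : IsZetaSolution t θ (zeta t θ) :=
  (isZetaSolution_iff ht hθ).2 ⟨zeta_mem ht hθ.le, tanMap_zeta ht hθ.le⟩

/-- Both `tanDomain` and the equation are compatible with translation by `π`. This lets `tan ∘ zeta`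
descend to a function of `e^{2iθ}`. -/
lemma zeta_add_int_mul_pi {θ : ℂ} (hθ : 0 ≤ θ.im) (n : ℤ) :
    zeta t (θ + n * Real.pi) = zeta t θ + n * Real.pi := by
  symm
  have hz := zeta_mem ht hθ
  have him : (zeta t θ + n * Real.pi).im = (zeta t θ).im := by
    rw [← Complex.ofReal_intCast, ← Complex.ofReal_mul, Complex.add_im, Complex.ofReal_im,
      add_zero]
  refine eq_zeta ht ⟨?_, ?_⟩ ?_
  · rw [him]; exact hz.1
  · have hre : (zeta t θ + n * Real.pi).re = (zeta t θ).re + n * Real.pi := by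
      rw [← Complex.ofReal_intCast, ← Complex.ofReal_mul, Complex.add_re, Complex.ofReal_re]
    have hs : ((-1 : ℝ) ^ n) ^ 2 = 1 := by
      rcases Int.even_or_odd n with h | h <;> simp [h.neg_one_zpow]
    rw [him, normSq_cos, him, hre, Real.cos_add_int_mul_pi, mul_pow, hs, one_mul, ← normSq_cos]
    exact hz.2
  · rw [tanMap, Complex.tan_add_int_mul_pi]
    conv_rhs => rw [← tanMap_zeta ht hθ, tanMap]
    ring

open ComplexConjugate in
lemma zeta_neg_conj {θ : ℂ} (hθ : 0 ≤ θ.im) : zeta t (-conj θ) = -conj (zeta t θ) := by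
  symm
  have hz := zeta_mem ht hθ
  refine eq_zeta ht ⟨by simpa using hz.1, ?_⟩ ?_
  · rw [Complex.cos_neg, Complex.cos_conj, Complex.normSq_conj]
    simpa using hz.2
  · conv_rhs => rw [← tanMap_zeta ht hθ]
    simp only [tanMap, Complex.tan_neg, Complex.tan_conj, map_sub, map_mul, Complex.conj_ofReal]
    ring

/-- Where `ζ_t` is not real it extends analytically. -/
lemma exists_analyticAt_eq_zeta {θ : ℂ} (hθ : 0 ≤ θ.im) (hpos : 0 < (zeta t θ).im) :
    ∃ g : ℂ → ℂ, AnalyticAt ℂ g θ ∧ ∀ᶠ η in 𝓝 θ, 0 ≤ η.im → g η = zeta t η := by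
  have hz := zeta_mem ht hθ
  have hd := hasStrictDerivAt_tanMap ht hz
  have hd0 : deriv (tanMap t) (zeta t θ) ≠ 0 := by
    rw [hd.hasDerivAt.deriv]; exact deriv_tanMap_ne_zero ht hz hpos
  have hF := tanMap_zeta ht hθ
  have han := analyticAt_tanMap ht hz
  have h1 := han.analyticAt_localInverse hd0
  have h2 := han.hasStrictDerivAt.eventually_right_inverse hd0
  have h3 : HasStrictDerivAt.localInverse (tanMap t) _ (zeta t θ) han.hasStrictDerivAt hd0
      (tanMap t (zeta t θ)) = zeta t θ :=
    (han.hasStrictDerivAt.eventually_left_inverse hd0).self_of_nhds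
  have h4 := h1.continuousAt
  rw [ContinuousAt, h3] at h4
  have h5 := h4 ((isOpen_lt continuous_const Complex.continuous_im).mem_nhds hpos)
  rw [hF] at h1 h2 h5
  refine ⟨_, h1, ?_⟩
  -- Near `θ` the local inverse stays in the open half-plane, so for `Im η ≥ 0` its values lie in
  -- `tanDomain` and injectivity identifies them with `zeta`.
  filter_upwards [h2, h5] with η hη1 hη2 hη
  exact eq_zeta ht (mem_tanDomain_of_im_pos hη2 (by rw [hη1]; exact hη)) hη1

lemma differentiableAt_zeta {θ : ℂ} (hθ : 0 < θ.im) : DifferentiableAt ℂ (zeta t) θ := by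
  obtain ⟨g, hg, h⟩ := exists_analyticAt_eq_zeta ht hθ.le (im_zeta_pos ht hθ)
  refine hg.differentiableAt.congr_of_eventuallyEq ?_
  filter_upwards [h, (isOpen_lt continuous_const Complex.continuous_im).mem_nhds hθ] with η h1 h2
  exact (h1 (le_of_lt h2)).symm

lemma analyticAt_im_zeta_ofReal {x : ℝ} (hpos : 0 < (zeta t x).im) :
    AnalyticAt ℝ (fun x : ℝ => (zeta t x).im) x := by
  obtain ⟨g, hg, h⟩ := exists_analyticAt_eq_zeta ht (θ := x) (by simp) hpos
  have h1 : AnalyticAt ℝ (fun x : ℝ => (g x).im) x := by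
    have h2 : AnalyticAt ℝ g ((Complex.ofRealCLM) x) := hg.restrictScalars
    exact (Complex.imCLM.analyticAt _).comp (h2.comp (Complex.ofRealCLM.analyticAt x))
  refine h1.congr ?_
  filter_upwards [Complex.continuous_ofReal.continuousAt.eventually h] with y hy
  rw [hy (by simp)]

end

/-! ### The Herglotz transform on the closed unit disc -/

/-- The Herglotz transform `1 + 2 ψ` of the free unitary normal distribution. -/
def herglotz (t : ℝ) (z : ℂ) : ℂ :=
  if z = 0 then 1
  else -Complex.I * Complex.tan (zeta t (Complex.log (-z) / (2 * Complex.I)))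

@[simp] lemma herglotz_zero (t : ℝ) : herglotz t 0 = 1 := if_pos rfl

lemma norm_exp_two_mul_I_mul (θ : ℂ) :
    ‖Complex.exp (2 * Complex.I * θ)‖ = Real.exp (-2 * θ.im) := by
  rw [Complex.norm_exp]
  simp

lemma norm_exp_two_mul_I_mul_le_one {θ : ℂ} :
    ‖Complex.exp (2 * Complex.I * θ)‖ ≤ 1 ↔ 0 ≤ θ.im := by
  rw [norm_exp_two_mul_I_mul, Real.exp_le_one_iff]
  constructor <;> intro h <;> linarith

lemma norm_exp_two_mul_I_mul_lt_one {θ : ℂ} :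
    ‖Complex.exp (2 * Complex.I * θ)‖ < 1 ↔ 0 < θ.im := by
  rw [norm_exp_two_mul_I_mul, Real.exp_lt_one_iff]
  constructor <;> intro h <;> linarith

lemma exists_eq_neg_exp {z : ℂ} (hz : z ≠ 0) :
    ∃ θ : ℂ, z = -Complex.exp (2 * Complex.I * θ) := by
  refine ⟨Complex.log (-z) / (2 * Complex.I), ?_⟩
  rw [mul_div_cancel₀ _ (by simp), Complex.exp_log (by simpa using hz), neg_neg]

section

variable {t : ℝ} (ht : 0 < t)
include ht

lemma herglotz_neg_exp {θ : ℂ} (hθ : 0 ≤ θ.im) :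
    herglotz t (-Complex.exp (2 * Complex.I * θ)) = -Complex.I * Complex.tan (zeta t θ) := by
  rw [herglotz, if_neg (by simp), neg_neg]
  obtain ⟨n, hn⟩ := Complex.exp_eq_exp_iff_exists_int.1
    (Complex.exp_log (Complex.exp_ne_zero (2 * Complex.I * θ)))
  have : Complex.log (Complex.exp (2 * Complex.I * θ)) / (2 * Complex.I) = θ + n * Real.pi := by
    rw [hn]
    field_simp
  rw [this, zeta_add_int_mul_pi ht hθ, Complex.tan_add_int_mul_pi]

/-- Eliminating the tangent through the equation for `ζ_t` shows that for real `θ` the real part is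
`Im ζ_t(θ) / t`, the form needed for the density. -/
lemma herglotz_neg_exp_eq {θ : ℂ} (hθ : 0 ≤ θ.im) :
    herglotz t (-Complex.exp (2 * Complex.I * θ)) = -Complex.I * ((zeta t θ - θ) / t) := by
  have ht0 : (t : ℂ) ≠ 0 := by exact_mod_cast ht.ne'
  rw [herglotz_neg_exp ht hθ]
  have h : zeta t θ - θ = t * Complex.tan (zeta t θ) := by
    conv_lhs => rw [← congrArg (zeta t θ - ·) (tanMap_zeta ht hθ)]
    rw [tanMap, sub_sub_cancel]
  rw [h, mul_div_cancel_left₀ _ ht0]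

lemma re_herglotz_nonneg {z : ℂ} (hz : ‖z‖ ≤ 1) : 0 ≤ (herglotz t z).re := by
  by_cases h0 : z = 0
  · simp [h0]
  · obtain ⟨θ, rfl⟩ := exists_eq_neg_exp h0
    rw [norm_neg, norm_exp_two_mul_I_mul_le_one] at hz
    have hm := zeta_mem ht hz
    have h1 := im_tan_mul_normSq_cos (cos_ne_zero ht hm)
    have h2 : 0 < Complex.normSq (Complex.cos (zeta t θ)) :=
      Complex.normSq_pos.2 (cos_ne_zero ht hm)
    rw [herglotz_neg_exp ht hz]
    have h3 : 0 ≤ (Complex.tan (zeta t θ)).im := by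
      refine nonneg_of_mul_nonneg_left ?_ h2
      rw [h1]
      exact mul_nonneg hm.1 (zero_le_one.trans (one_le_sinhc (by linarith [hm.1])))
    simpa using h3

lemma norm_herglotz_le {z : ℂ} (hz : ‖z‖ ≤ 1) : ‖herglotz t z‖ ≤ 1 + 1 / t := by
  by_cases h0 : z = 0
  · have : 0 ≤ 1 / t := by positivity
    simpa [h0] using this
  · obtain ⟨θ, rfl⟩ := exists_eq_neg_exp h0
    rw [norm_neg, norm_exp_two_mul_I_mul_le_one] at hz
    rw [herglotz_neg_exp ht hz]
    simpa using norm_tan_le ht (zeta_mem ht hz)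

lemma herglotz_equation {z : ℂ} (hz : ‖z‖ ≤ 1) :
    z * (herglotz t z + 1) = (herglotz t z - 1) * Complex.exp (2 * t * herglotz t z) := by
  by_cases h0 : z = 0
  · simp [h0]
  · obtain ⟨θ, rfl⟩ := exists_eq_neg_exp h0
    rw [norm_neg, norm_exp_two_mul_I_mul_le_one] at hz
    have hm := zeta_mem ht hz
    have hc := cos_ne_zero ht hm
    have hF := tanMap_zeta ht hz
    rw [herglotz_neg_exp ht hz]
    set ζ := zeta t θ
    -- Exponentiate `θ = ζ - t tan ζ`; the factor `e^{2iζ}` is then a Möbius function of `-i tan ζ`,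
    -- which is `h3` below.
    have h1 : Complex.exp (2 * Complex.I * θ) = Complex.exp (Complex.I * ζ) ^ 2 *
        Complex.exp (2 * t * (-Complex.I * Complex.tan ζ)) := by
      rw [← Complex.exp_nat_mul, ← Complex.exp_add, ← hF, tanMap]
      congr 1
      push_cast
      ring
    rw [h1]
    have h2 : Complex.exp (Complex.I * ζ) = Complex.cos ζ + Complex.sin ζ * Complex.I := by
      rw [mul_comm, Complex.exp_mul_I]
    rw [h2]
    have h3 : -(Complex.cos ζ + Complex.sin ζ * Complex.I) ^ 2 *
        (-Complex.I * Complex.tan ζ + 1) = -Complex.I * Complex.tan ζ - 1 := by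
      rw [Complex.tan_eq_sin_div_cos]
      have h4 := Complex.sin_sq_add_cos_sq ζ
      field_simp
      linear_combination (Complex.cos ζ * Complex.sin ζ ^ 2 +
        Complex.I * Complex.sin ζ ^ 3) * Complex.I_sq - (Complex.cos ζ + Complex.I * Complex.sin ζ) * h4
    generalize Complex.exp (2 * t * (-Complex.I * Complex.tan ζ)) = E
    generalize Complex.tan ζ = T at h3 ⊢
    linear_combination E * h3

/-- The logarithm in `herglotz` has a cut along the positive axis; using `log (z / z₀)` gives a
branch of `θ` that is holomorphic at the chosen point. -/
lemma herglotz_eq_comp {z₀ : ℂ} (hz₀ : z₀ ≠ 0) : ∃ θ : ℂ → ℂ, DifferentiableAt ℂ θ z₀ ∧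
    z₀ = -Complex.exp (2 * Complex.I * θ z₀) ∧
    ∀ᶠ z in 𝓝 z₀, ‖z‖ ≤ 1 →
      0 ≤ (θ z).im ∧ herglotz t z = -Complex.I * Complex.tan (zeta t (θ z)) := by
  obtain ⟨θ₀, hθ₀⟩ := exists_eq_neg_exp hz₀
  have hd : DifferentiableAt ℂ (fun z => θ₀ + Complex.log (z / z₀) / (2 * Complex.I)) z₀ := by
    refine (differentiableAt_const _).add (DifferentiableAt.div_const ?_ _)
    refine (differentiableAt_id.div_const z₀).clog ?_
    simp [hz₀]
  have he : ∀ z : ℂ, z ≠ 0 →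
      z = -Complex.exp (2 * Complex.I * (θ₀ + Complex.log (z / z₀) / (2 * Complex.I))) := by
    intro z hz
    rw [mul_add, mul_div_cancel₀ _ (by simp), Complex.exp_add, Complex.exp_log (div_ne_zero hz hz₀),
      ← neg_mul, ← hθ₀, mul_div_cancel₀ _ hz₀]
  refine ⟨_, hd, he z₀ hz₀, ?_⟩
  filter_upwards [isOpen_ne.mem_nhds hz₀] with z hz hz1
  have h1 : 0 ≤ (θ₀ + Complex.log (z / z₀) / (2 * Complex.I)).im := by
    rw [← norm_exp_two_mul_I_mul_le_one, ← norm_neg, ← he z hz]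
    exact hz1
  refine ⟨h1, ?_⟩
  conv_lhs => rw [he z hz]
  exact herglotz_neg_exp ht h1

lemma continuousOn_herglotz : ContinuousOn (herglotz t) (Metric.closedBall 0 1) := by
  intro z₀ hz₀
  have hz₀' : ‖z₀‖ ≤ 1 := by simpa using hz₀
  by_cases h0 : z₀ = 0
  · subst h0
    rw [ContinuousWithinAt, herglotz_zero, tendsto_iff_norm_sub_tendsto_zero]
    have hlim : Tendsto (fun z : ℂ => ‖z‖ * (1 + 1 / t + 1)) (𝓝[Metric.closedBall 0 1] 0) (𝓝 0) := by
      have : Continuous fun z : ℂ => ‖z‖ * (1 + 1 / t + 1) := by fun_prop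
      simpa using (this.tendsto 0).mono_left nhdsWithin_le_nhds
    refine squeeze_zero' (Eventually.of_forall fun _ => norm_nonneg _) ?_ hlim
    filter_upwards [self_mem_nhdsWithin] with z hz
    have hz' : ‖z‖ ≤ 1 := by simpa using hz
    have h1 := congrArg norm (herglotz_equation ht hz')
    rw [norm_mul, norm_mul, Complex.norm_exp] at h1
    -- Since `Re H ≥ 0`, the exponential in the functional equation only enlarges `H - 1`, whence
    -- `|H - 1| ≤ |z| |H + 1|`.
    have h2 : 1 ≤ Real.exp (2 * t * herglotz t z).re := by
      rw [Real.one_le_exp_iff, ← Complex.ofReal_ofNat, ← Complex.ofReal_mul, Complex.re_ofReal_mul]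
      exact mul_nonneg (by positivity) (re_herglotz_nonneg ht hz')
    calc ‖herglotz t z - 1‖ ≤ ‖herglotz t z - 1‖ * Real.exp (2 * t * herglotz t z).re :=
          le_mul_of_one_le_right (norm_nonneg _) h2
      _ = ‖z‖ * ‖herglotz t z + 1‖ := h1.symm
      _ ≤ ‖z‖ * (1 + 1 / t + 1) := by
        gcongr
        exact (norm_add_le _ _).trans (by simpa using norm_herglotz_le ht hz')
  · obtain ⟨θ, hd, -, he⟩ := herglotz_eq_comp ht h0
    obtain ⟨him, heq⟩ := he.self_of_nhds hz₀'
    have hmap : ∀ᶠ z in 𝓝[Metric.closedBall 0 1] z₀, 0 ≤ (θ z).im ∧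
        herglotz t z = -Complex.I * Complex.tan (zeta t (θ z)) := by
      filter_upwards [self_mem_nhdsWithin, mem_nhdsWithin_of_mem_nhds he] with z hz h
      exact h (by simpa using hz)
    have h1 : Tendsto θ (𝓝[Metric.closedBall 0 1] z₀) (𝓝[{θ : ℂ | 0 ≤ θ.im}] (θ z₀)) :=
      tendsto_nhdsWithin_iff.2 ⟨hd.continuousAt.mono_left nhdsWithin_le_nhds,
        hmap.mono fun _ h => h.1⟩
    have h2 : Tendsto (fun z => -Complex.I * Complex.tan (zeta t (θ z)))
        (𝓝[Metric.closedBall 0 1] z₀) (𝓝 (-Complex.I * Complex.tan (zeta t (θ z₀)))) :=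
      (((Complex.continuousAt_tan.2 (cos_ne_zero ht (zeta_mem ht him))).tendsto.comp
        ((continuousOn_zeta ht _ him).tendsto.comp h1))).const_mul _
    rw [ContinuousWithinAt, heq]
    exact h2.congr' (hmap.mono fun _ h => h.2.symm)

lemma differentiableOn_herglotz : DifferentiableOn ℂ (herglotz t) (Metric.ball 0 1) := by
  have hnhds : Metric.ball (0 : ℂ) 1 ∈ 𝓝 (0 : ℂ) := Metric.ball_mem_nhds _ one_pos
  -- The origin, where no `θ` exists, is a removable singularity by continuity.
  rw [← Complex.differentiableOn_compl_singleton_and_continuousAt_iff hnhds]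
  constructor
  · rintro z₀ ⟨hz₀, h0⟩
    have hz₀' : ‖z₀‖ < 1 := by simpa using hz₀
    obtain ⟨θ, hd, hθ, he⟩ := herglotz_eq_comp ht h0
    have him : 0 < (θ z₀).im := by
      rw [← norm_exp_two_mul_I_mul_lt_one, ← norm_neg, ← hθ]
      exact hz₀'
    have h1 : DifferentiableAt ℂ (fun z => -Complex.I * Complex.tan (zeta t (θ z))) z₀ := by
      have h2 : DifferentiableAt ℂ (fun z => zeta t (θ z)) z₀ :=
        (differentiableAt_zeta ht him).comp z₀ hd
      have h3 : DifferentiableAt ℂ Complex.tan (zeta t (θ z₀)) :=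
        Complex.differentiableAt_tan.2 (cos_ne_zero ht (zeta_mem ht him.le))
      exact (h3.comp z₀ h2).const_mul _
    refine (h1.congr_of_eventuallyEq ?_).differentiableWithinAt
    filter_upwards [he, Metric.isOpen_ball.mem_nhds hz₀] with z hz hz1
    exact (hz (by simpa using (Metric.mem_ball.1 hz1).le)).2
  · exact (continuousOn_herglotz ht).continuousAt (Metric.closedBall_mem_nhds _ one_pos)

lemma diffContOnCl_herglotz : DiffContOnCl ℂ (herglotz t) (Metric.ball 0 1) := by
  refine ⟨differentiableOn_herglotz ht, ?_⟩
  rw [closure_ball _ one_ne_zero]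
  exact continuousOn_herglotz ht

open ComplexConjugate in
lemma herglotz_conj {z : ℂ} (hz : ‖z‖ ≤ 1) : herglotz t (conj z) = conj (herglotz t z) := by
  by_cases h0 : z = 0
  · simp [h0]
  · obtain ⟨θ, rfl⟩ := exists_eq_neg_exp h0
    rw [norm_neg, norm_exp_two_mul_I_mul_le_one] at hz
    have h1 : conj (-Complex.exp (2 * Complex.I * θ)) =
        -Complex.exp (2 * Complex.I * (-conj θ)) := by
      rw [map_neg, ← Complex.exp_conj]
      simp [Complex.conj_ofNat]
    rw [h1, herglotz_neg_exp ht hz, herglotz_neg_exp ht (by simpa using hz), zeta_neg_conj ht hz]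
    simp [Complex.tan_conj]

end

/-! ### Measures on the circle and their `ψ`-transforms -/

lemma continuous_integrable {μ : Measure Circle} [IsFiniteMeasure μ] {E : Type*}
    [NormedAddCommGroup E] [SecondCountableTopology E] {g : Circle → E} (hg : Continuous g) :
    Integrable g μ := by
  obtain ⟨C, hC⟩ := (isCompact_range hg).isBounded.exists_norm_le
  exact Integrable.of_bound hg.aestronglyMeasurable C (.of_forall fun u => hC _ (mem_range_self u))

/-- The formal power series with the moments of `μ` as coefficients. -/
def momentSeries (μ : Measure Circle) : FormalMultilinearSeries ℂ ℂ ℂ :=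
  .ofScalars ℂ fun n => if n = 0 then 0 else ∫ u : Circle, (u : ℂ) ^ n ∂μ

lemma hasFPowerSeriesAt_psiTransform (μ : Measure Circle) [IsFiniteMeasure μ] :
    HasFPowerSeriesAt (psiTransform μ) (momentSeries μ) 0 := by
  rw [hasFPowerSeriesAt_iff]
  filter_upwards [Metric.ball_mem_nhds (0 : ℂ) one_pos] with z hz
  have hz' : ‖z‖ < 1 := by simpa using hz
  set F : ℕ → Circle → ℂ := fun n u => if n = 0 then 0 else z ^ n * (u : ℂ) ^ n with hF
  have hFc : ∀ n, Continuous (F n) := by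
    intro n
    by_cases h : n = 0
    · simp only [hF, h, if_true]; exact continuous_const
    · simp only [hF, h, if_false]; fun_prop
  have hFn : ∀ n u, ‖F n u‖ ≤ ‖z‖ ^ n := by
    intro n u
    by_cases h : n = 0 <;> simp [hF, h, Circle.norm_coe]
  have h1 := hasSum_integral_of_summable_integral_norm (μ := μ) (F := F)
    (fun n => continuous_integrable (hFc n)) ?_
  · have h2 : ∀ u : Circle, ∑' n, F n u = ((u : ℂ) * z) / (1 - (u : ℂ) * z) := by
      intro u
      have hn : ‖(u : ℂ) * z‖ < 1 := by simpa [Circle.norm_coe] using hz'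
      refine HasSum.tsum_eq ?_
      have h3 := (hasSum_geometric_of_norm_lt_one hn).mul_left ((u : ℂ) * z)
      rw [← hasSum_nat_add_iff' 1]
      simp only [hF, Finset.range_one, Finset.sum_singleton, if_true, sub_zero, Nat.add_eq_zero_iff,
        one_ne_zero, and_false, if_false]
      rw [div_eq_mul_inv]
      refine (congrArg (fun f => HasSum f _) (funext fun n => ?_)).mpr h3
      ring
    simp only [h2] at h1
    rw [zero_add]
    refine (congrArg (fun f => HasSum f _) (funext fun n => ?_)).mpr h1
    rw [momentSeries, FormalMultilinearSeries.coeff_ofScalars]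
    by_cases h : n = 0 <;> simp [hF, h, integral_const_mul]
  · refine Summable.of_nonneg_of_le (fun n => integral_nonneg fun u => norm_nonneg _) (fun n => ?_)
      ((summable_geometric_of_lt_one (norm_nonneg z) hz').mul_right (μ.real univ))
    calc ∫ u, ‖F n u‖ ∂μ ≤ ∫ u, ‖z‖ ^ n ∂μ :=
          integral_mono (continuous_integrable (hFc n).norm) (integrable_const _) (hFn n)
      _ = _ := by rw [integral_const, smul_eq_mul, mul_comm]

@[simp] lemma psiTransform_zero (μ : Measure Circle) : psiTransform μ 0 = 0 := by
  simp [psiTransform]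

lemma hasDerivAt_psiTransform (μ : Measure Circle) [IsFiniteMeasure μ] :
    HasDerivAt (psiTransform μ) (∫ u : Circle, (u : ℂ) ∂μ) 0 := by
  have := (hasFPowerSeriesAt_psiTransform μ).hasDerivAt
  simpa [momentSeries, FormalMultilinearSeries.ofScalars_apply_eq] using this

instance : Fact (0 < 2 * Real.pi) := ⟨by positivity⟩

/-- A finite measure on the circle is determined by its Fourier coefficients. -/
lemma ext_of_integral_zpow {μ ν : Measure Circle} [IsFiniteMeasure μ] [IsFiniteMeasure ν]
    (h : ∀ n : ℤ, ∫ u : Circle, (u : ℂ) ^ n ∂μ = ∫ u : Circle, (u : ℂ) ^ n ∂ν) : μ = ν := by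
  set φ : C(AddCircle (2 * Real.pi), Circle) :=
    ⟨AddCircle.homeomorphCircle', AddCircle.homeomorphCircle'.continuous⟩ with hφ
  set Φ : BoundedContinuousFunction Circle ℂ →⋆ₐ[ℂ] C(AddCircle (2 * Real.pi), ℂ) :=
    (ContinuousMap.compStarAlgHom' ℂ ℂ φ).comp
        (BoundedContinuousFunction.toContinuousMapStarₐ ℂ) with hΦ
  -- The Laurent polynomials in `u`, obtained by pulling back the Fourier subalgebra; the coordinate
  -- `u` alone separates points.
  set A : StarSubalgebra ℂ (BoundedContinuousFunction Circle ℂ) :=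
    (fourierSubalgebra (T := 2 * Real.pi)).comap Φ with hA
  have hφx : ∀ (x : AddCircle (2 * Real.pi)) (n : ℤ), (fourier n x : ℂ) = (φ x : ℂ) ^ n := by
    intro x n
    induction x using QuotientAddGroup.induction_on with
    | H x =>
      have : φ (x : AddCircle (2 * Real.pi)) = Circle.exp x := rfl
      rw [this]
      have h2 := fourier_coe_apply (T := 2 * Real.pi) (n := n) (x := x)
      rw [show fourier n (QuotientAddGroup.mk x : AddCircle (2 * Real.pi)) = _ from h2,
        Circle.coe_exp, ← Complex.exp_int_mul]
      congr 1
      have : (Real.pi : ℂ) ≠ 0 := by exact_mod_cast Real.pi_ne_zero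
      push_cast
      field_simp
  refine ext_of_forall_mem_subalgebra_integral_eq_of_pseudoEMetric_complete_countable
    (𝕜 := ℂ) (A := A) ?_ ?_
  · intro x y hxy
    set g : BoundedContinuousFunction Circle ℂ := .mkOfCompact ⟨fun u => (u : ℂ), by fun_prop⟩
      with hg
    have h1 : fourier 1 ∈ fourierSubalgebra (T := 2 * Real.pi) :=
      Algebra.subset_adjoin ⟨1, rfl⟩
    have h2 : Φ g = fourier 1 := by
      ext x
      rw [hφx, zpow_one]
      rfl
    have h3 : g ∈ A := by
      rw [hA, StarSubalgebra.mem_comap, h2]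
      exact h1
    exact ⟨_, ⟨_, ⟨g, h3, rfl⟩, rfl⟩, fun hne => hxy (Circle.ext hne)⟩
  · intro g hg
    set ψ : C(Circle, AddCircle (2 * Real.pi)) :=
      ⟨AddCircle.homeomorphCircle'.symm, AddCircle.homeomorphCircle'.symm.continuous⟩ with hψ
    have hφψ : ∀ u, φ (ψ u) = u := AddCircle.homeomorphCircle'.apply_symm_apply
    have hspan : ∀ f ∈ Submodule.span ℂ (range (fourier (T := 2 * Real.pi))),
        ∫ u, f (ψ u) ∂μ = ∫ u, f (ψ u) ∂ν := by
      intro f hf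
      induction hf using Submodule.span_induction with
      | mem f hf =>
        obtain ⟨n, rfl⟩ := hf
        simpa only [hφx, hφψ] using h n
      | zero => simp
      | add f₁ f₂ _ _ h₁ h₂ =>
        have hi : ∀ (f : C(AddCircle (2 * Real.pi), ℂ)), Continuous fun u => f (ψ u) :=
          fun f => f.continuous.comp ψ.continuous
        simp only [ContinuousMap.add_apply]
        rw [integral_add (continuous_integrable (hi f₁)) (continuous_integrable (hi f₂)),
          integral_add (continuous_integrable (hi f₁)) (continuous_integrable (hi f₂)), h₁, h₂]
      | smul c f _ h₁ =>
        simp only [ContinuousMap.smul_apply, integral_smul, h₁]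
    have hg' : (g : C(Circle, ℂ)).comp φ ∈ Submodule.span ℂ (range (fourier (T := 2 * Real.pi))) := by
      rw [← fourierSubalgebra_coe]
      exact hg
    have := hspan _ hg'
    simpa [hφψ] using this

lemma integral_zpow_neg (μ : Measure Circle) (n : ℤ) :
    ∫ u : Circle, (u : ℂ) ^ (-n) ∂μ = (starRingEnd ℂ) (∫ u : Circle, (u : ℂ) ^ n ∂μ) := by
  rw [← integral_conj]
  refine integral_congr_ae (.of_forall fun u => ?_)
  simp only [map_zpow₀, ← Circle.coe_inv_eq_conj, Circle.coe_inv, inv_zpow, zpow_neg]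

/-- A probability measure on the circle is determined by its `ψ`-transform near `0`. -/
lemma ext_of_psiTransform {μ ν : Measure Circle} [IsProbabilityMeasure μ] [IsProbabilityMeasure ν]
    (h : psiTransform μ =ᶠ[𝓝 0] psiTransform ν) : μ = ν := by
  have h1 := ((hasFPowerSeriesAt_psiTransform μ).congr h).eq_formalMultilinearSeries
    (hasFPowerSeriesAt_psiTransform ν)
  have h2 : ∀ n : ℕ, ∫ u : Circle, (u : ℂ) ^ n ∂μ = ∫ u : Circle, (u : ℂ) ^ n ∂ν := by
    intro n
    by_cases hn : n = 0
    · simp [hn]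
    · have := congrArg (fun p => FormalMultilinearSeries.coeff p n) h1
      simpa [momentSeries, FormalMultilinearSeries.coeff_ofScalars, hn] using this
  refine ext_of_integral_zpow fun n => ?_
  obtain ⟨m, rfl | rfl⟩ := n.eq_nat_or_neg
  · simpa using h2 m
  · rw [integral_zpow_neg, integral_zpow_neg]
    simpa using congrArg _ (h2 m)

lemma integral_lengthMeasure {G : ℂ → ℂ} (hG : Continuous fun u : Circle => G u) :
    ∫ u : Circle, G u ∂lengthMeasure = 2 * Real.pi * Real.circleAverage G 0 1 := by
  rw [lengthMeasure, integral_map Circle.exp.continuous.aemeasurable hG.aestronglyMeasurable,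
    ← intervalIntegral.integral_of_le (by linarith [Real.pi_pos]),
    Real.circleAverage_eq_integral_add (-Real.pi),
    intervalIntegral.integral_comp_add_right (fun θ => G (circleMap 0 1 θ)), zero_add,
    show 2 * Real.pi + -Real.pi = Real.pi by ring, Complex.real_smul]
  push_cast
  rw [mul_inv_cancel_left₀ (by simp)]
  simp only [circleMap_zero, Complex.ofReal_one, one_mul]

instance : IsFiniteMeasure lengthMeasure := by
  unfold lengthMeasure
  infer_instance

/-! ### The free unitary normal distribution -/

/-- The density of the free unitary normal distribution with `σ² = 4 t`. -/
def density (t : ℝ) (u : Circle) : ℝ := (2 * Real.pi)⁻¹ * (herglotz t u).re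

/-- The free unitary normal distribution with `σ² = 4 t`. -/
def normalMeasure (t : ℝ) : Measure Circle :=
  lengthMeasure.withDensity fun u => ENNReal.ofReal (density t u)

/-- The right-hand side of `χ = ψ⁻¹` for the free unitary normal distribution. -/
def normalChi (t : ℝ) (w : ℂ) : ℂ := w / (1 + w) * Complex.exp (4 * t * (w + 1 / 2))

lemma analyticAt_normalChi (t : ℝ) : AnalyticAt ℂ (normalChi t) 0 := by
  have h : (1 : ℂ) + 0 ≠ 0 := by simp
  unfold normalChi
  fun_prop (disch := assumption)

@[simp] lemma normalChi_zero (t : ℝ) : normalChi t 0 = 0 := by simp [normalChi]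

lemma deriv_normalChi_ne_zero (t : ℝ) : deriv (normalChi t) 0 ≠ 0 := by
  have h1 : HasDerivAt (fun w : ℂ => w / (1 + w)) ((1 * (1 + 0) - 0 * 1) / (1 + 0) ^ 2) 0 :=
    (hasDerivAt_id (0 : ℂ)).div ((hasDerivAt_id (0 : ℂ)).const_add 1) (by simp)
  have h2 : DifferentiableAt ℂ (fun w : ℂ => Complex.exp (4 * t * (w + 1 / 2))) 0 := by fun_prop
  have h3 := (h1.mul h2.hasDerivAt).deriv
  have h4 : deriv (normalChi t) 0 = Complex.exp (4 * t * (0 + 1 / 2)) := by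
    rw [show normalChi t = (fun w : ℂ => w / (1 + w)) *
      (fun w : ℂ => Complex.exp (4 * t * (w + 1 / 2))) from rfl, h3]
    simp
  rw [h4]
  exact Complex.exp_ne_zero _

section

variable {t : ℝ} (ht : 0 < t)
include ht

lemma continuous_herglotz_circle : Continuous fun u : Circle => herglotz t u :=
  (continuousOn_herglotz ht).comp_continuous (by fun_prop)
    fun u => by simp [Circle.norm_coe]

lemma continuous_density : Continuous (density t) :=
  continuous_const.mul (Complex.continuous_re.comp (continuous_herglotz_circle ht))

lemma density_nonneg (u : Circle) : 0 ≤ density t u :=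
  mul_nonneg (by positivity) (re_herglotz_nonneg ht (Circle.norm_coe u).le)

lemma density_exp (θ : ℝ) :
    density t (Circle.exp θ) =
      1 / (2 * Real.pi * t) * (zeta t (((θ - Real.pi) / 2 : ℝ) : ℂ)).im := by
  have h1 : ((Circle.exp θ : Circle) : ℂ) =
      -Complex.exp (2 * Complex.I * (((θ - Real.pi) / 2 : ℝ) : ℂ)) := by
    rw [Circle.coe_exp]
    have : 2 * Complex.I * (((θ - Real.pi) / 2 : ℝ) : ℂ) = θ * Complex.I - Real.pi * Complex.I := by
      push_cast; ring
    rw [this, Complex.exp_sub, Complex.exp_pi_mul_I, div_neg, neg_neg, div_one]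
  rw [density, h1, herglotz_neg_exp_eq ht (by simp)]
  have h2 : ∀ z : ℂ, (-Complex.I * z).re = z.im := fun z => by simp
  rw [h2, Complex.div_ofReal_im, Complex.sub_im, Complex.ofReal_im, sub_zero]
  field_simp

lemma density_exp_neg (θ : ℝ) : density t (Circle.exp (-θ)) = density t (Circle.exp θ) := by
  rw [Circle.exp_neg, density, Circle.coe_inv_eq_conj, herglotz_conj ht (Circle.norm_coe _).le,
    Complex.conj_re, density]

lemma isFiniteMeasure_normalMeasure : IsFiniteMeasure (normalMeasure t) :=
  isFiniteMeasure_withDensity_ofReal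
    (continuous_integrable (continuous_density ht)).hasFiniteIntegral

lemma integral_normalMeasure {G : ℂ → ℂ} (hG : Continuous fun u : Circle => G u) :
    ∫ u : Circle, G u ∂(normalMeasure t) =
      Real.circleAverage (fun z => ((herglotz t z).re : ℂ) * G z) 0 1 := by
  rw [normalMeasure, integral_withDensity_eq_integral_toReal_smul
    (by have := (continuous_density ht).measurable; fun_prop) (by simp)]
  have h1 : ∀ u : Circle, (ENNReal.ofReal (density t u)).toReal • G u =
      (fun z : ℂ => ((2 * Real.pi)⁻¹ : ℂ) * (((herglotz t z).re : ℂ) * G z)) u := by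
    intro u
    rw [ENNReal.toReal_ofReal (density_nonneg ht u), Complex.real_smul, density]
    push_cast
    ring
  simp only [h1]
  have hc : Continuous fun u : Circle => ((2 * Real.pi)⁻¹ : ℂ) * (((herglotz t u).re : ℂ) * G u) :=
    continuous_const.mul ((Complex.continuous_ofReal.comp
      (Complex.continuous_re.comp (continuous_herglotz_circle ht))).mul hG)
  refine (integral_lengthMeasure
    (G := fun z => ((2 * Real.pi)⁻¹ : ℂ) * (((herglotz t z).re : ℂ) * G z)) hc).trans ?_
  have h2 := Real.circleAverage_fun_smul (a := ((2 * Real.pi)⁻¹ : ℂ))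
    (f := fun z => ((herglotz t z).re : ℂ) * G z) (c := 0) (R := 1)
  simp only [smul_eq_mul] at h2
  rw [h2, mul_inv_cancel_left₀ (by simp)]

lemma continuousOn_herglotz_mul {G : ℂ → ℂ} (hG : ContinuousOn G (Metric.sphere 0 1)) :
    ContinuousOn (fun z => herglotz t z * G z) (Metric.sphere 0 1) :=
  ((continuousOn_herglotz ht).mono Metric.sphere_subset_closedBall).mul hG

/-- On the circle the conjugate of `H(z)` is `H(z⁻¹)`, and the substitution `z ↦ z⁻¹` moves the
inversion to `G`. Both averages then contain the holomorphic `H`, so Cauchy's theorem applies. -/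
lemma circleAverage_re_herglotz_mul {G : ℂ → ℂ} (hG : ContinuousOn G (Metric.sphere 0 1)) :
    Real.circleAverage (fun z => ((herglotz t z).re : ℂ) * G z) 0 1 =
      (Real.circleAverage (fun z => herglotz t z * G z) 0 1 +
        Real.circleAverage (fun z => herglotz t z * G z⁻¹) 0 1) / 2 := by
  have hG' : ContinuousOn (fun z => G z⁻¹) (Metric.sphere 0 1) := by
    refine hG.comp (continuousOn_id.inv₀ fun z hz => ?_) fun z hz => ?_
    · exact Metric.ne_of_mem_sphere hz one_ne_zero
    · simp_all
  have h1 : CircleIntegrable (fun z => herglotz t z * G z) 0 1 :=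
    (continuousOn_herglotz_mul ht hG).circleIntegrable zero_le_one
  have h2 : CircleIntegrable (fun z => herglotz t z⁻¹ * G z) 0 1 := by
    refine ContinuousOn.circleIntegrable zero_le_one ?_
    refine ContinuousOn.mul ?_ hG
    refine (continuousOn_herglotz ht).comp (continuousOn_id.inv₀ fun z hz => ?_) fun z hz => ?_
    · exact Metric.ne_of_mem_sphere hz one_ne_zero
    · simp_all
  have h3 := Real.circleAverage_zero_one_congr_inv (f := fun z => herglotz t z⁻¹ * G z)
  simp only [inv_inv] at h3
  rw [h3, ← Real.circleAverage_fun_add h1 h2, div_eq_inv_mul, ← smul_eq_mul,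
    ← Real.circleAverage_fun_smul]
  refine Real.circleAverage_congr_sphere fun z hz => ?_
  have hz' : ‖z‖ = 1 := by simpa using hz
  have h4 : z⁻¹ = (starRingEnd ℂ) z := Complex.inv_eq_conj hz'
  simp only [smul_eq_mul]
  rw [h4, herglotz_conj ht hz'.le, Complex.re_eq_add_conj]
  ring

lemma circleAverage_herglotz : Real.circleAverage (herglotz t) 0 1 = 1 := by
  have h := DiffContOnCl.circleAverage (f := herglotz t) (c := 0) (R := 1)
    (by simpa using diffContOnCl_herglotz ht)
  rw [h, herglotz_zero]

lemma isProbabilityMeasure_normalMeasure : IsProbabilityMeasure (normalMeasure t) := by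
  have := isFiniteMeasure_normalMeasure ht
  have h1 := integral_normalMeasure ht (G := fun _ => 1) continuous_const
  rw [circleAverage_re_herglotz_mul ht continuousOn_const] at h1
  simp only [mul_one, circleAverage_herglotz ht, integral_const, Complex.real_smul] at h1
  norm_num at h1
  refine ⟨?_⟩
  rw [← ENNReal.toReal_eq_one_iff]
  exact h1

lemma psiTransform_normalMeasure {z : ℂ} (hz : ‖z‖ < 1) :
    psiTransform (normalMeasure t) z = (herglotz t z - 1) / 2 := by
  have hne : ∀ u ∈ Metric.closedBall (0 : ℂ) 1, 1 - u * z ≠ 0 := by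
    intro u hu h
    have h1 : ‖u * z‖ = 1 := by rw [← sub_eq_zero.1 h, norm_one]
    rw [norm_mul] at h1
    have h2 : ‖u‖ ≤ 1 := by simpa using hu
    nlinarith [norm_nonneg z]
  have hGc : ContinuousOn (fun u : ℂ => u * z / (1 - u * z)) (Metric.closedBall 0 1) :=
    ContinuousOn.div (by fun_prop) (by fun_prop) hne
  have hGs := hGc.mono Metric.sphere_subset_closedBall
  have hGC : Continuous fun u : Circle => (u : ℂ) * z / (1 - (u : ℂ) * z) :=
    hGc.comp_continuous (by fun_prop) fun u => by simp [Circle.norm_coe]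
  rw [psiTransform, integral_normalMeasure ht (G := fun u : ℂ => u * z / (1 - u * z)) hGC,
    circleAverage_re_herglotz_mul ht hGs]
  -- The integrand is holomorphic in `u` on the disc and vanishes at `0`.
  have h1 : Real.circleAverage (fun u => herglotz t u * (u * z / (1 - u * z))) 0 1 = 0 := by
    have h := DiffContOnCl.circleAverage
      (f := fun u => herglotz t u * (u * z / (1 - u * z))) (c := 0) (R := 1) ?_
    · simpa using h
    · rw [abs_one]
      refine ⟨(differentiableOn_herglotz ht).mul (DifferentiableOn.div (by fun_prop) (by fun_prop)
        fun u hu => hne u (Metric.ball_subset_closedBall hu)), ?_⟩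
      rw [closure_ball _ one_ne_zero]
      exact (continuousOn_herglotz ht).mul hGc
  -- Here the kernel is `z / (u - z) = u / (u - z) - 1`: the Cauchy kernel minus the mean.
  have h2 : Real.circleAverage (fun u => herglotz t u * (u⁻¹ * z / (1 - u⁻¹ * z))) 0 1 =
      herglotz t z - 1 := by
    have h := DiffContOnCl.circleAverage_smul_div (f := herglotz t) (c := 0) (R := 1) (w := z)
      (by simpa using diffContOnCl_herglotz ht) (by simpa using hz)
    have hnz : ∀ u ∈ Metric.sphere (0 : ℂ) 1, u - z ≠ 0 := by
      intro u hu h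
      have : ‖u‖ = 1 := by simpa using hu
      rw [sub_eq_zero.1 h] at this
      exact hz.ne this
    conv_rhs => rw [← h, ← circleAverage_herglotz ht]
    rw [← Real.circleAverage_fun_sub]
    · refine Real.circleAverage_congr_sphere fun u hu => ?_
      rw [abs_one] at hu
      have hu0 : u ≠ 0 := Metric.ne_of_mem_sphere hu one_ne_zero
      have h3 := hnz u hu
      have h4 : 1 - u⁻¹ * z ≠ 0 := by
        rw [show 1 - u⁻¹ * z = u⁻¹ * (u - z) by field_simp]
        exact mul_ne_zero (inv_ne_zero hu0) h3
      simp only [smul_eq_mul, sub_zero]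
      rw [show 1 - u⁻¹ * z = u⁻¹ * (u - z) by field_simp]
      field_simp
      ring
    · refine ContinuousOn.circleIntegrable zero_le_one ?_
      simp only [smul_eq_mul, sub_zero]
      exact (ContinuousOn.div (by fun_prop) (by fun_prop) hnz).mul
        ((continuousOn_herglotz ht).mono Metric.sphere_subset_closedBall)
    · exact ((continuousOn_herglotz ht).mono Metric.sphere_subset_closedBall).circleIntegrable
        zero_le_one
  rw [h1, h2, zero_add]

lemma normalChi_psiTransform {z : ℂ} (hz : ‖z‖ < 1) :
    normalChi t (psiTransform (normalMeasure t) z) = z := by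
  have h1 := herglotz_equation ht hz.le
  have h2 : herglotz t z + 1 ≠ 0 := by
    intro h
    have := re_herglotz_nonneg ht hz.le
    rw [eq_neg_of_add_eq_zero_left h] at this
    norm_num at this
  rw [psiTransform_normalMeasure ht hz, normalChi]
  have h3 : 4 * (t : ℂ) * ((herglotz t z - 1) / 2 + 1 / 2) = 2 * t * herglotz t z := by ring
  have h4 : (1 : ℂ) + (herglotz t z - 1) / 2 = (herglotz t z + 1) / 2 := by ring
  rw [h3, h4, div_div_div_cancel_right₀ two_ne_zero, div_mul_eq_mul_div, ← h1,
    mul_div_cancel_right₀ _ h2]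

end

/-! ### Existence, uniqueness and symmetry of the distribution -/

/-- A local left inverse is a local right inverse. -/
lemma eventually_eq_of_left_inverse {χ ψ : ℂ → ℂ} (hχ : AnalyticAt ℂ χ 0) (hχ0 : χ 0 = 0)
    (hχ' : deriv χ 0 ≠ 0) (hψ : ContinuousAt ψ 0) (hψ0 : ψ 0 = 0)
    (h : ∀ᶠ z in 𝓝 (0 : ℂ), χ (ψ z) = z) : ∀ᶠ w in 𝓝 (0 : ℂ), ψ (χ w) = w := by
  have h1 := hχ.hasStrictDerivAt.eventually_left_inverse hχ'
  have h2 : Tendsto χ (𝓝 0) (𝓝 0) := by simpa [ContinuousAt, hχ0] using hχ.continuousAt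
  have h3 : Tendsto ψ (𝓝 0) (𝓝 0) := by simpa [ContinuousAt, hψ0] using hψ
  filter_upwards [h1, (h3.comp h2).eventually h1, h2.eventually h] with w hw1 hw2 hw3
  simp only [Function.comp_apply] at hw2
  rw [hw3, hw1] at hw2
  exact hw2.symm

variable {σ : ℝ}

lemma isFreeUnitaryNormal_normalMeasure (hσ : 0 < σ) :
    IsFreeUnitaryNormal σ (normalMeasure (σ ^ 2 / 4)) := by
  have ht : 0 < σ ^ 2 / 4 := by positivity
  have hp := isProbabilityMeasure_normalMeasure ht
  have hd := hasDerivAt_psiTransform (normalMeasure (σ ^ 2 / 4))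
  have hleft : ∀ᶠ z in 𝓝 (0 : ℂ),
      normalChi (σ ^ 2 / 4) (psiTransform (normalMeasure (σ ^ 2 / 4)) z) = z := by
    filter_upwards [Metric.ball_mem_nhds (0 : ℂ) one_pos] with z hz
    exact normalChi_psiTransform ht (by simpa using hz)
  refine ⟨hp, ?_, normalChi (σ ^ 2 / 4), analyticAt_normalChi _, normalChi_zero _, hleft, ?_, ?_⟩
  -- By the chain rule `χ'(0)` times the first moment is `1`.
  · intro h0
    rw [h0] at hd
    have h1 : HasDerivAt (normalChi (σ ^ 2 / 4)) (deriv (normalChi (σ ^ 2 / 4)) 0)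
        (psiTransform (normalMeasure (σ ^ 2 / 4)) 0) := by
      rw [psiTransform_zero]
      exact (analyticAt_normalChi _).differentiableAt.hasDerivAt
    have h2 := (h1.comp 0 hd).congr_of_eventuallyEq (f₁ := id) (hleft.mono fun z hz => hz.symm)
    have := h2.unique (hasDerivAt_id _)
    simp at this
  · exact eventually_eq_of_left_inverse (analyticAt_normalChi _) (normalChi_zero _)
      (deriv_normalChi_ne_zero _) hd.continuousAt (psiTransform_zero _) hleft
  · have h1 : ∀ᶠ w in 𝓝 (0 : ℂ), 1 + w ≠ 0 := by
      have : Tendsto (fun w : ℂ => 1 + w) (𝓝 0) (𝓝 (1 + 0)) := by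
        exact (continuous_const.add continuous_id).tendsto 0
      exact this.eventually_ne (by simp)
    filter_upwards [self_mem_nhdsWithin, mem_nhdsWithin_of_mem_nhds h1] with w hw hw1
    have hw0 : w ≠ 0 := hw
    have hw1' : 1 + w ≠ 0 := hw1
    rw [normalChi]
    push_cast
    rw [mul_div_cancel₀ _ (by norm_num : (4 : ℂ) ≠ 0)]
    field_simp

lemma IsFreeUnitaryNormal.eq_normalMeasure (hσ : 0 < σ) {μ : Measure Circle}
    (h : IsFreeUnitaryNormal σ μ) : μ = normalMeasure (σ ^ 2 / 4) := by
  have ht : 0 < σ ^ 2 / 4 := by positivity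
  obtain ⟨hμ, -, χ, hχ, hχ0, hl, hr, hS⟩ := h
  have hp := isProbabilityMeasure_normalMeasure ht
  have hχeq : ∀ᶠ w in 𝓝 (0 : ℂ), χ w = normalChi (σ ^ 2 / 4) w := by
    have h1 : ∀ᶠ w in 𝓝 (0 : ℂ), 1 + w ≠ 0 := by
      have : Tendsto (fun w : ℂ => 1 + w) (𝓝 0) (𝓝 (1 + 0)) := by
        exact (continuous_const.add continuous_id).tendsto 0
      exact this.eventually_ne (by simp)
    filter_upwards [eventually_nhdsWithin_iff.1 hS, h1] with w hw hw1
    by_cases hw0 : w = 0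
    · rw [hw0, hχ0, normalChi_zero]
    · have h2 := hw hw0
      rw [normalChi]
      push_cast
      rw [mul_div_cancel₀ _ (by norm_num : (4 : ℂ) ≠ 0), h2]
      field_simp
  have hd := (hasDerivAt_psiTransform μ).continuousAt
  have h3 : Tendsto (psiTransform μ) (𝓝 0) (𝓝 0) := by
    simpa [ContinuousAt, psiTransform_zero] using hd
  have hd' := (hasDerivAt_psiTransform (normalMeasure (σ ^ 2 / 4))).continuousAt
  have hleft : ∀ᶠ z in 𝓝 (0 : ℂ),
      normalChi (σ ^ 2 / 4) (psiTransform (normalMeasure (σ ^ 2 / 4)) z) = z := by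
    filter_upwards [Metric.ball_mem_nhds (0 : ℂ) one_pos] with z hz
    exact normalChi_psiTransform ht (by simpa using hz)
  have hright := eventually_eq_of_left_inverse (analyticAt_normalChi _) (normalChi_zero _)
      (deriv_normalChi_ne_zero _) hd' (psiTransform_zero _) hleft
  refine ext_of_psiTransform ?_
  filter_upwards [hl, h3.eventually hright, h3.eventually hχeq] with z h4 h5 h6
  rw [h4] at h6
  rw [← h6] at h5
  exact h5.symm

/-- Inversion turns `ψ(z)` into the conjugate of `ψ` at the conjugate of `z`, and `herglotz`
commutes with conjugation. -/
lemma map_inv_normalMeasure {t : ℝ} (ht : 0 < t) :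
    (normalMeasure t).map (fun u : Circle => u⁻¹) = normalMeasure t := by
  have hp := isProbabilityMeasure_normalMeasure ht
  have hm : Measurable fun u : Circle => u⁻¹ := continuous_inv.measurable
  have hp' := Measure.isProbabilityMeasure_map (μ := normalMeasure t) hm.aemeasurable
  refine ext_of_psiTransform ?_
  filter_upwards [Metric.ball_mem_nhds (0 : ℂ) one_pos] with z hz
  have hz' : ‖z‖ < 1 := by simpa using hz
  have hconj : psiTransform ((normalMeasure t).map fun u : Circle => u⁻¹) z =
      (starRingEnd ℂ) (psiTransform (normalMeasure t) ((starRingEnd ℂ) z)) := by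
    rw [psiTransform, psiTransform, integral_map hm.aemeasurable, ← integral_conj]
    · refine integral_congr_ae (.of_forall fun u => ?_)
      beta_reduce
      rw [Circle.coe_inv_eq_conj]
      simp
    · refine Continuous.aestronglyMeasurable (Continuous.div (by fun_prop) (by fun_prop) ?_)
      intro u h
      have h1 : ‖(u : ℂ) * z‖ = 1 := by rw [← sub_eq_zero.1 h, norm_one]
      rw [norm_mul, Circle.norm_coe, one_mul] at h1
      exact hz'.ne h1
  have hzc : ‖(starRingEnd ℂ) z‖ < 1 := by simpa using hz'
  rw [hconj, psiTransform_normalMeasure ht hzc, psiTransform_normalMeasure ht hz',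
    herglotz_conj ht hz'.le]
  simp [Complex.conj_ofNat]

/-! ### The zeros of the density -/

lemma im_zeta_ofReal_eq_zero_iff {t : ℝ} (ht : 0 < t) (x : ℝ) :
    (zeta t x).im = 0 ↔ ∃ y : ℝ, t ≤ Real.cos y ^ 2 ∧ y - t * Real.tan y = x := by
  have hz := zeta_mem ht (θ := x) (by simp)
  have hF := tanMap_zeta ht (θ := x) (by simp)
  constructor
  · intro h
    refine ⟨(zeta t x).re, ?_, ?_⟩
    · have h1 := hz.2
      rw [h, normSq_cos, h] at h1
      simpa using h1
    · have h2 : zeta t x = ((zeta t x).re : ℂ) := Complex.ext (by simp) (by simpa using h)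
      rw [h2, tanMap] at hF
      exact_mod_cast hF
  · rintro ⟨y, hy, hyx⟩
    have h1 : (y : ℂ) ∈ tanDomain t := by
      refine ⟨by simp, ?_⟩
      rw [normSq_cos]
      simpa using hy
    have h2 : tanMap t y = x := by
      rw [tanMap, ← hyx]
      push_cast
      ring
    rw [← eq_zeta ht h1 h2]
    simp

lemma zeta_ofReal_sub_mul_tan {t : ℝ} (ht : 0 < t) {y : ℝ} (hy : t ≤ Real.cos y ^ 2) :
    zeta t ((y - t * Real.tan y : ℝ) : ℂ) = y := by
  symm
  refine eq_zeta ht ⟨by simp, ?_⟩ ?_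
  · rw [normSq_cos]
    simpa using hy
  · rw [tanMap]
    push_cast
    ring

lemma im_zeta_ofReal_nonneg {t : ℝ} (ht : 0 < t) (x : ℝ) : 0 ≤ (zeta t x).im :=
  (zeta_mem ht (θ := x) (by simp)).1

lemma im_zeta_ofReal_pos_of_one_lt {t : ℝ} (ht : 1 < t) (x : ℝ) : 0 < (zeta t x).im := by
  have ht0 : 0 < t := by linarith
  refine lt_of_le_of_ne (im_zeta_ofReal_nonneg ht0 x) fun h => ?_
  obtain ⟨y, hy, -⟩ := (im_zeta_ofReal_eq_zero_iff ht0 x).1 h.symm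
  linarith [Real.cos_sq_le_one y]

lemma continuous_zeta_ofReal {t : ℝ} (ht : 0 < t) : Continuous fun x : ℝ => zeta t x :=
  (continuousOn_zeta ht).comp_continuous Complex.continuous_ofReal fun x => by simp

/-! ### Real critical points and the endpoints of the arc -/

section

variable {σ : ℝ} (hσ : 0 < σ) (hσ2 : σ ≤ 2)
include hσ hσ2

omit hσ2 in
lemma arccos_mem_Ico : Real.arccos (σ / 2) ∈ Ico 0 (Real.pi / 2) :=
  ⟨Real.arccos_nonneg _, Real.arccos_lt_pi_div_two.2 (by positivity)⟩

lemma cos_arccos_sq : Real.cos (Real.arccos (σ / 2)) ^ 2 = σ ^ 2 / 4 := by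
  rw [Real.cos_arccos (by linarith) (by linarith)]
  ring

omit hσ2 in
lemma tan_arccos_div_two : Real.tan (Real.arccos (σ / 2)) = Real.sqrt (4 - σ ^ 2) / σ := by
  rw [Real.tan_arccos, show 1 - (σ / 2) ^ 2 = (4 - σ ^ 2) / 2 ^ 2 by ring,
    Real.sqrt_div' _ (by positivity), Real.sqrt_sq (by positivity)]
  field_simp

omit hσ2 in
-- For `σ ≤ 2`, `arccos (σ / 2)` is the critical point of `y - t tan y` where `cos² y = t`; its
-- value is what makes `arcHalfLength` the edge of the support.
lemma arccos_sub_mul_tan :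
    Real.arccos (σ / 2) - σ ^ 2 / 4 * Real.tan (Real.arccos (σ / 2)) =
      (Real.pi - arcHalfLength σ) / 2 := by
  rw [tan_arccos_div_two hσ, arcHalfLength, Real.arccos]
  field_simp
  ring

lemma le_cos_sq_of_abs_le {y : ℝ} (hy : |y| ≤ Real.arccos (σ / 2)) :
    σ ^ 2 / 4 ≤ Real.cos y ^ 2 := by
  have hα := arccos_mem_Ico hσ
  rw [← cos_arccos_sq hσ hσ2, ← Real.cos_abs y]
  have h1 := Real.cos_le_cos_of_nonneg_of_le_pi (abs_nonneg y) (by linarith [hα.2, Real.pi_pos]) hy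
  have h2 : 0 ≤ Real.cos (Real.arccos (σ / 2)) :=
    Real.cos_nonneg_of_mem_Icc ⟨by linarith [hα.1, Real.pi_pos], hα.2.le⟩
  gcongr

lemma abs_le_of_le_cos_sq {y : ℝ} (hy : |y| ≤ Real.pi / 2) (h : σ ^ 2 / 4 ≤ Real.cos y ^ 2) :
    |y| ≤ Real.arccos (σ / 2) := by
  have hα := arccos_mem_Ico hσ
  by_contra! hlt
  have h1 := Real.cos_lt_cos_of_nonneg_of_le_pi_div_two hα.1 hy hlt
  have h2 : 0 ≤ Real.cos |y| :=
    Real.cos_nonneg_of_mem_Icc ⟨by linarith [abs_nonneg y, Real.pi_pos], hy⟩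
  rw [← cos_arccos_sq hσ hσ2, ← Real.cos_abs y] at h
  nlinarith

omit hσ2 in
lemma continuousOn_sub_mul_tan : ContinuousOn (fun y : ℝ => y - σ ^ 2 / 4 * Real.tan y)
    (Icc (-Real.arccos (σ / 2)) (Real.arccos (σ / 2))) := by
  have hα := arccos_mem_Ico hσ
  refine continuousOn_id.sub (continuousOn_const.mul
    (Real.continuousOn_tan_Ioo.mono fun y hy => ⟨?_, ?_⟩))
  · linarith [hy.1, hα.2]
  · linarith [hy.2, hα.2]

lemma monotoneOn_sub_mul_tan : MonotoneOn (fun y : ℝ => y - σ ^ 2 / 4 * Real.tan y)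
    (Icc (-Real.arccos (σ / 2)) (Real.arccos (σ / 2))) := by
  have hα := arccos_mem_Ico hσ
  have hd : ∀ y ∈ interior (Icc (-Real.arccos (σ / 2)) (Real.arccos (σ / 2))),
      HasDerivAt (fun y : ℝ => y - σ ^ 2 / 4 * Real.tan y)
        (1 - σ ^ 2 / 4 * (1 / Real.cos y ^ 2)) y ∧ σ ^ 2 / 4 ≤ Real.cos y ^ 2 := by
    intro y hy
    rw [interior_Icc] at hy
    have h1 := le_cos_sq_of_abs_le hσ hσ2 (abs_le.2 ⟨hy.1.le, hy.2.le⟩)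
    have h2 : Real.cos y ≠ 0 := by
      intro h
      rw [h] at h1
      have : 0 < σ ^ 2 / 4 := by positivity
      norm_num at h1
      linarith
    exact ⟨(hasDerivAt_id y).sub ((Real.hasDerivAt_tan h2).const_mul _), h1⟩
  refine monotoneOn_of_deriv_nonneg (convex_Icc _ _) (continuousOn_sub_mul_tan hσ)
    (fun y hy => (hd y hy).1.differentiableAt.differentiableWithinAt) fun y hy => ?_
  obtain ⟨h1, h2⟩ := hd y hy
  have h3 : 0 < Real.cos y ^ 2 := lt_of_lt_of_le (by positivity) h2
  rw [h1.deriv, sub_nonneg, mul_one_div, div_le_one h3]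
  exact h2

lemma abs_sub_mul_tan_le {y : ℝ} (hy : |y| ≤ Real.pi / 2) (h : σ ^ 2 / 4 ≤ Real.cos y ^ 2) :
    |y - σ ^ 2 / 4 * Real.tan y| ≤ (Real.pi - arcHalfLength σ) / 2 := by
  have h1 := abs_le.1 (abs_le_of_le_cos_sq hσ hσ2 hy h)
  have hα := arccos_mem_Ico hσ
  have hm := monotoneOn_sub_mul_tan hσ hσ2
  have h2 := hm h1 ⟨by linarith [hα.1], le_rfl⟩ h1.2
  have h3 := hm ⟨le_rfl, by linarith [hα.1]⟩ h1 h1.1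
  have h4 := arccos_sub_mul_tan hσ
  simp only [Real.tan_neg] at h2 h3
  rw [abs_le]
  constructor <;> linarith

omit hσ2 in
lemma arcHalfLength_pos : 0 < arcHalfLength σ := by
  have h1 : 0 < Real.arcsin (σ / 2) := Real.arcsin_pos.2 (by positivity)
  unfold arcHalfLength
  positivity

lemma arcHalfLength_le_pi : arcHalfLength σ ≤ Real.pi := by
  have h := abs_sub_mul_tan_le hσ hσ2 (y := 0) (by simpa using Real.pi_div_two_pos.le) (by
    simp; nlinarith)
  have := (abs_nonneg _).trans h
  linarith

/-- A real value `y`, reduced by the nearest multiple `kπ`, would put `θ` within `π - arcHalfLength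
σ` of the odd multiple `(2k + 1)π`. This excludes `θ < arcHalfLength σ` for `k ≥ 0` and
`-arcHalfLength σ < θ` for `k ≤ -1`. -/
lemma im_zeta_pos_of_mem_Ioo {θ : ℝ} (hθ : θ ∈ Ioo (-arcHalfLength σ) (arcHalfLength σ)) :
    0 < (zeta (σ ^ 2 / 4) (((θ - Real.pi) / 2 : ℝ) : ℂ)).im := by
  have ht : 0 < σ ^ 2 / 4 := by positivity
  refine lt_of_le_of_ne (im_zeta_ofReal_nonneg ht _) fun h => ?_
  obtain ⟨y, hy, hyθ⟩ := (im_zeta_ofReal_eq_zero_iff ht _).1 h.symm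
  have hpi := Real.pi_pos
  set k : ℤ := round (y / Real.pi) with hk
  have h1 : |y - k * Real.pi| ≤ Real.pi / 2 := by
    have h2 := abs_sub_round (y / Real.pi)
    rw [← hk] at h2
    have h3 : y - k * Real.pi = (y / Real.pi - k) * Real.pi := by field_simp
    rw [h3, abs_mul, abs_of_pos hpi]
    nlinarith
  have h2 : σ ^ 2 / 4 ≤ Real.cos (y - k * Real.pi) ^ 2 := by
    have hs : ((-1 : ℝ) ^ k) ^ 2 = 1 := by
      rcases Int.even_or_odd k with h | h <;> simp [h.neg_one_zpow]
    rw [Real.cos_sub_int_mul_pi, mul_pow, hs, one_mul]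
    exact hy
  have h3 := abs_le.1 (abs_sub_mul_tan_le hσ hσ2 h1 h2)
  rw [Real.tan_sub_int_mul_pi] at h3
  rcases le_or_gt 0 k with h0 | h0
  · have : (0 : ℝ) ≤ k := by exact_mod_cast h0
    nlinarith [hθ.2, h3.1, mul_nonneg this hpi.le]
  · have : (k : ℝ) ≤ -1 := by exact_mod_cast (by omega : k ≤ -1)
    nlinarith [hθ.1, h3.2]

lemma im_zeta_eq_zero_of_mem_Icc {θ : ℝ} (hθ : θ ∈ Icc (arcHalfLength σ) Real.pi) :
    (zeta (σ ^ 2 / 4) (((θ - Real.pi) / 2 : ℝ) : ℂ)).im = 0 := by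
  have ht : 0 < σ ^ 2 / 4 := by positivity
  have hα := arccos_mem_Ico hσ
  have h4 := arccos_sub_mul_tan hσ
  rw [im_zeta_ofReal_eq_zero_iff ht]
  have hc := (continuousOn_sub_mul_tan hσ).mono
    (Icc_subset_Icc_right hα.1 : Icc (-Real.arccos (σ / 2)) 0 ⊆ _)
  -- On `[-arccos (σ/2), 0]` the function `y - t tan y` takes all values from `-(π - arcHalfLength
  -- σ)/2` to `0`.
  have hI := intermediate_value_Icc (by linarith [hα.1]) hc
  have hmem : (θ - Real.pi) / 2 ∈ Icc
      (-Real.arccos (σ / 2) - σ ^ 2 / 4 * Real.tan (-Real.arccos (σ / 2)))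
      (0 - σ ^ 2 / 4 * Real.tan 0) := by
    rw [Real.tan_neg, Real.tan_zero]
    constructor <;> linarith [hθ.1, hθ.2]
  obtain ⟨y, hy, hyθ⟩ := hI hmem
  exact ⟨y, le_cos_sq_of_abs_le hσ hσ2 (abs_le.2 ⟨hy.1, hy.2.trans hα.1⟩), hyθ⟩

end

lemma arcHalfLength_eq_integral {σ : ℝ} (hσ : 0 < σ) (hσ2 : σ < 2) :
    arcHalfLength σ = ∫ s in (0 : ℝ)..σ, Real.sqrt (4 - s ^ 2) := by
  have hd : ∀ s ∈ uIcc 0 σ, HasDerivAt arcHalfLength (Real.sqrt (4 - s ^ 2)) s := by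
    intro s hs
    rw [uIcc_of_le hσ.le] at hs
    have h4 : 0 < 4 - s ^ 2 := by nlinarith [hs.1, hs.2]
    have hq : 0 < Real.sqrt (4 - s ^ 2) := Real.sqrt_pos.2 h4
    have hq2 : Real.sqrt (4 - s ^ 2) ^ 2 = 4 - s ^ 2 := Real.sq_sqrt h4.le
    have h1 : HasDerivAt (fun s : ℝ => s / 2) (1 / 2) s := (hasDerivAt_id s).div_const 2
    have h2 : HasDerivAt (fun s : ℝ => Real.arcsin (s / 2))
        (1 / Real.sqrt (1 - (s / 2) ^ 2) * (1 / 2)) s :=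
      (Real.hasDerivAt_arcsin (by linarith [hs.1]) (by linarith [hs.2])).comp s h1
    have h3 : HasDerivAt (fun s : ℝ => 4 - s ^ 2) (-(2 * s)) s := by
      simpa using (hasDerivAt_pow 2 s).const_sub 4
    have h5 := (h2.const_mul 2).add (h1.mul (h3.sqrt h4.ne'))
    have h6 : Real.sqrt (1 - (s / 2) ^ 2) = Real.sqrt (4 - s ^ 2) / 2 := by
      rw [show 1 - (s / 2) ^ 2 = (4 - s ^ 2) / 2 ^ 2 by ring,
        Real.sqrt_div' _ (by positivity), Real.sqrt_sq (by positivity)]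
    rw [h6] at h5
    refine h5.congr_deriv ?_
    field_simp
    linear_combination -hq2
  rw [intervalIntegral.integral_eq_sub_of_hasDerivAt hd]
  · simp [arcHalfLength]
  · exact (Continuous.intervalIntegrable (by fun_prop) _ _)

/-! ### Asymptotics at the edge of the support -/

/-- The continuous extension of `(sin h - h cos h) / h ^ 3`. -/
def sinSubRatio (h : ℂ) : ℂ :=
  if h = 0 then 1 / 3 else (Complex.sin h - h * Complex.cos h) / h ^ 3

lemma pow_three_mul_sinSubRatio (h : ℂ) :
    h ^ 3 * sinSubRatio h = Complex.sin h - h * Complex.cos h := by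
  by_cases h0 : h = 0
  · simp [h0]
  · rw [sinSubRatio, if_neg h0, mul_div_cancel₀ _ (pow_ne_zero 3 h0)]

lemma tendsto_sinSubRatio : Tendsto sinSubRatio (𝓝 0) (𝓝 (1 / 3)) := by
  rw [tendsto_iff_norm_sub_tendsto_zero]
  have hlim : Tendsto (fun h : ℂ => ‖h‖ ^ 2) (𝓝 0) (𝓝 0) := by
    have : Continuous fun h : ℂ => ‖h‖ ^ 2 := by fun_prop
    simpa using this.tendsto 0
  refine squeeze_zero' (Eventually.of_forall fun _ => norm_nonneg _) ?_ hlim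
  filter_upwards [Metric.closedBall_mem_nhds (0 : ℂ) one_pos] with h hh
  have hh' : ‖h‖ ≤ 1 := by simpa using hh
  by_cases h0 : h = 0
  · simp [h0, sinSubRatio]
  · have hpos : 0 < ‖h‖ := norm_pos_iff.2 h0
    have h1 : sinSubRatio h - 1 / 3 = ((Complex.sin h - (h - h ^ 3 / 6)) -
        h * (Complex.cos h - (1 - h ^ 2 / 2))) / h ^ 3 := by
      rw [eq_div_iff (pow_ne_zero 3 h0), sub_mul, mul_comm, pow_three_mul_sinSubRatio]
      ring
    rw [h1, norm_div, norm_pow, div_le_iff₀ (by positivity)]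
    refine (norm_sub_le _ _).trans ?_
    rw [norm_mul]
    have h2 := Complex.sin_bound hh'
    have h3 := mul_le_mul_of_nonneg_left (Complex.cos_bound hh') hpos.le
    nlinarith [pow_pos hpos 5]

lemma tendsto_dslope_sin : Tendsto (dslope Complex.sin 0) (𝓝 0) (𝓝 1) := by
  have h := (continuousAt_dslope_same (f := Complex.sin) (a := 0)).2
    (Complex.differentiable_sin 0)
  rw [ContinuousAt, dslope_same] at h
  simpa using h

lemma mul_dslope_sin (h : ℂ) : h * dslope Complex.sin 0 h = Complex.sin h := by
  simpa using sub_smul_dslope Complex.sin 0 h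

/-- Second order expansion of `ζ ↦ ζ - t tan ζ` at a critical point. -/
lemma exists_tanMap_sub_eq {t : ℝ} {a : ℂ} (ha : Complex.cos a ^ 2 = t) (ha0 : Complex.cos a ≠ 0) :
    ∃ g : ℂ → ℂ, Tendsto g (𝓝 a) (𝓝 (-Complex.tan a)) ∧
      ∀ᶠ ζ in 𝓝 a, tanMap t ζ - tanMap t a = (ζ - a) ^ 2 * g ζ := by
  -- With `h = ζ - a` and `t = cos² a`, the difference times `cos ζ` is `-(cos a (sin h - h cos h) +
  -- h sin a sin h)`; divide by `h²`.
  refine ⟨fun ζ => -(Complex.cos a * ((ζ - a) * sinSubRatio (ζ - a)) +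
    dslope Complex.sin 0 (ζ - a) * Complex.sin a) / Complex.cos ζ, ?_, ?_⟩
  · have h0 : Tendsto (fun ζ => ζ - a) (𝓝 a) (𝓝 0) := by
      have : Continuous fun ζ : ℂ => ζ - a := by fun_prop
      simpa using this.tendsto a
    have h1 := (((h0.mul (tendsto_sinSubRatio.comp h0)).const_mul (Complex.cos a)).add
      ((tendsto_dslope_sin.comp h0).mul_const (Complex.sin a))).neg.div
        (Complex.continuous_cos.tendsto a) ha0
    simpa [Complex.tan_eq_sin_div_cos, neg_div, Pi.div_def] using h1
  · filter_upwards [Complex.continuous_cos.continuousAt.eventually_ne ha0] with ζ hζ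
    have h1 := pow_three_mul_sinSubRatio (ζ - a)
    have h2 := mul_dslope_sin (ζ - a)
    have h3 : Complex.sin ζ = Complex.sin a * Complex.cos (ζ - a) +
        Complex.cos a * Complex.sin (ζ - a) := by
      rw [← Complex.sin_add, add_sub_cancel]
    have h4 : Complex.cos ζ = Complex.cos a * Complex.cos (ζ - a) -
        Complex.sin a * Complex.sin (ζ - a) := by
      rw [← Complex.cos_add, add_sub_cancel]
    have h5 := Complex.sin_sq_add_cos_sq a
    simp only [tanMap, Complex.tan_eq_sin_div_cos, ← ha]
    rw [mul_div_assoc' ((ζ - a) ^ 2), eq_div_iff hζ]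
    have h6 : (ζ - Complex.cos a ^ 2 * (Complex.sin ζ / Complex.cos ζ) -
        (a - Complex.cos a ^ 2 * (Complex.sin a / Complex.cos a))) * Complex.cos ζ =
        (ζ - a) * Complex.cos ζ - Complex.cos a ^ 2 * Complex.sin ζ +
          Complex.cos a * Complex.sin a * Complex.cos ζ := by
      field_simp
      ring
    rw [h6, h3, h4]
    linear_combination Complex.cos a * h1 + (ζ - a) * Complex.sin a * h2 -
      Complex.cos a * Complex.sin (ζ - a) * h5

/-- A square root in the upper half-plane is continuous at negative numbers. -/
lemma tendsto_im_of_sq_tendsto {ι : Type*} {l : Filter ι} {w : ι → ℂ} {κ : ℝ} (hκ : 0 < κ)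
    (him : ∀ᶠ i in l, 0 ≤ (w i).im)
    (h : Tendsto (fun i => w i ^ 2) l (𝓝 (-(κ : ℂ) ^ 2))) :
    Tendsto (fun i => (w i).im) l (𝓝 κ) := by
  have h1 : Tendsto w l (𝓝 (κ * Complex.I)) := by
    rw [tendsto_iff_norm_sub_tendsto_zero] at h ⊢
    have h2 : Tendsto (fun i => ‖w i ^ 2 - -(κ : ℂ) ^ 2‖ / κ) l (𝓝 0) := by
      simpa using h.div_const κ
    refine squeeze_zero' (Eventually.of_forall fun _ => norm_nonneg _) ?_ h2
    filter_upwards [him] with i hi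
    rw [le_div_iff₀ hκ]
    -- The second factor has imaginary part at least `κ`, so the first must tend to `0`.
    have h3 : w i ^ 2 - -(κ : ℂ) ^ 2 = (w i - κ * Complex.I) * (w i + κ * Complex.I) := by
      linear_combination (κ : ℂ) ^ 2 * Complex.I_sq
    rw [h3, norm_mul]
    gcongr
    refine le_trans ?_ (Complex.abs_im_le_norm _)
    have : (w i + κ * Complex.I).im = (w i).im + κ := by simp
    rw [this]
    exact le_trans (by linarith) (le_abs_self _)
  simpa [Function.comp_def] using (Complex.continuous_im.tendsto _).comp h1

/-- The cube root with argument in `(0, π)` is continuous at positive numbers. -/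
lemma tendsto_im_of_cube_tendsto {ι : Type*} {l : Filter ι} {w : ι → ℂ} {ρ : ℝ} (hρ : 0 < ρ)
    (him : ∀ᶠ i in l, |(w i).re| ≤ 4 * (w i).im)
    (h : Tendsto (fun i => w i ^ 3) l (𝓝 ((ρ : ℂ) ^ 3))) :
    Tendsto (fun i => (w i).im) l (𝓝 (ρ * (Real.sqrt 3 / 2))) := by
  set c : ℂ := ⟨-(1 / 2), Real.sqrt 3 / 2⟩ with hc
  set d : ℂ := ⟨-(1 / 2), -(Real.sqrt 3 / 2)⟩ with hd
  have hs : Real.sqrt 3 * Real.sqrt 3 = 3 := Real.mul_self_sqrt (by norm_num)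
  have hs1 : 1 ≤ Real.sqrt 3 := Real.one_le_sqrt.2 (by norm_num)
  have hcd : c + d = -1 := by
    apply Complex.ext <;> simp [hc, hd]; norm_num
  have hcd' : c * d = 1 := by
    apply Complex.ext
    · simp [hc, hd]; linarith
    · simp [hc, hd]; ring
  have h1 : Tendsto w l (𝓝 (ρ * c)) := by
    rw [tendsto_iff_norm_sub_tendsto_zero] at h ⊢
    have h2 : Tendsto (fun i => ‖w i ^ 3 - (ρ : ℂ) ^ 3‖ / (ρ / 8 * (ρ / 2))) l (𝓝 0) := by
      simpa using h.div_const (ρ / 8 * (ρ / 2))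
    refine squeeze_zero' (Eventually.of_forall fun _ => norm_nonneg _) ?_ h2
    filter_upwards [him] with i hi
    rw [le_div_iff₀ (by positivity)]
    have h3 : w i ^ 3 - (ρ : ℂ) ^ 3 = (w i - ρ * c) * ((w i - ρ) * (w i - ρ * d)) := by
      linear_combination (ρ * w i * (w i - ρ)) * hcd - ρ ^ 2 * (w i - ρ) * hcd'
    rw [h3, norm_mul, norm_mul]
    have him0 : 0 ≤ (w i).im := by linarith [abs_nonneg (w i).re]
    gcongr
    -- If `Re w ≥ ρ/2`, the sector condition gives `Im w ≥ ρ/8`; this keeps `w` away from the real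
    -- root `ρ`. The root `ρ d` is excluded because it lies in the lower half-plane.
    · rcases le_total (w i).re (ρ / 2) with hr | hr
      · refine le_trans ?_ (Complex.abs_re_le_norm _)
        have : (w i - ρ).re = (w i).re - ρ := by simp
        rw [this]
        refine le_trans ?_ (neg_le_abs _)
        linarith
      · refine le_trans ?_ (Complex.abs_im_le_norm _)
        have : (w i - ρ).im = (w i).im := by simp
        rw [this, abs_of_nonneg him0]
        linarith [le_abs_self (w i).re]
    · refine le_trans ?_ (Complex.abs_im_le_norm _)
      have : (w i - ρ * d).im = (w i).im + ρ * (Real.sqrt 3 / 2) := by simp [hd]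
      rw [this]
      refine le_trans ?_ (le_abs_self _)
      nlinarith
  have h4 := (Complex.continuous_im.tendsto _).comp h1
  simpa [hc, Function.comp_def] using h4

/-- At the critical point `-α`, `α = arccos (σ / 2)`, the expansion gives `-ε/2 ≈ tan α (ζ + α)²`.
Hence `((ζ + α)/√ε)² → -1/(2 tan α)`, and the root in the upper half-plane is selected. -/
lemma tendsto_im_zeta_edge {σ : ℝ} (hσ : 0 < σ) (hσ2 : σ < 2) :
    Tendsto (fun ε : ℝ =>
      (zeta (σ ^ 2 / 4) (((arcHalfLength σ - ε - Real.pi) / 2 : ℝ) : ℂ)).im / Real.sqrt ε)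
      (𝓝[>] 0) (𝓝 ((4 * σ ^ 2 / (4 - σ ^ 2)) ^ (1 / 4 : ℝ) / 2)) := by
  have ht : 0 < σ ^ 2 / 4 := by positivity
  set t := σ ^ 2 / 4 with ht_def
  set α := Real.arccos (σ / 2) with hα_def
  have hα := arccos_mem_Ico hσ
  rw [← hα_def] at hα
  have h4 : 0 < 4 - σ ^ 2 := by nlinarith
  have htan : Real.tan α = Real.sqrt (4 - σ ^ 2) / σ := tan_arccos_div_two hσ
  have htan0 : 0 < Real.tan α := by rw [htan]; positivity
  have hcos : Real.cos (-α) ^ 2 = t := by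
    rw [Real.cos_neg]; exact cos_arccos_sq hσ hσ2.le
  have hp : -α - t * Real.tan (-α) = (arcHalfLength σ - Real.pi) / 2 := by
    have := arccos_sub_mul_tan hσ
    rw [← hα_def, ← ht_def] at this
    rw [Real.tan_neg]
    linarith
  set κ : ℝ := (4 * σ ^ 2 / (4 - σ ^ 2)) ^ (1 / 4 : ℝ) / 2 with hκ_def
  have hκ : 0 < κ := by positivity
  -- Compare squares: `(2κ)⁴ = 4 / tan² α`, and both sides are nonnegative.
  have hκ2 : κ ^ 2 * (2 * Real.tan α) = 1 := by
    have h5 : (2 * κ) ^ 4 = 4 * σ ^ 2 / (4 - σ ^ 2) := by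
      have : 2 * κ = (4 * σ ^ 2 / (4 - σ ^ 2)) ^ (((4 : ℕ) : ℝ)⁻¹) := by
        rw [hκ_def, mul_div_cancel₀ _ two_ne_zero]
        norm_num
      rw [this]
      exact Real.rpow_inv_natCast_pow (by positivity) (by norm_num)
    have h6 : (κ ^ 2 * (2 * Real.tan α)) ^ 2 = 1 ^ 2 := by
      have h7 : Real.tan α ^ 2 = (4 - σ ^ 2) / σ ^ 2 := by
        rw [htan, div_pow, Real.sq_sqrt h4.le]
      calc (κ ^ 2 * (2 * Real.tan α)) ^ 2 = (2 * κ) ^ 4 * Real.tan α ^ 2 / 4 := by ring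
        _ = 1 ^ 2 := by
          rw [h5, h7]
          field_simp
    exact (pow_left_inj₀ (by positivity) zero_le_one two_ne_zero).1 h6
  set a : ℂ := ((-α : ℝ) : ℂ) with ha_def
  have hca : Complex.cos a ^ 2 = (t : ℂ) := by
    rw [ha_def, ← Complex.ofReal_cos, ← hcos]
    push_cast
    rfl
  have hca0 : Complex.cos a ≠ 0 := by
    intro h
    rw [h] at hca
    have : (t : ℂ) ≠ 0 := by exact_mod_cast ht.ne'
    exact this (by rw [← hca]; simp)
  obtain ⟨g, hg, hgeq⟩ := exists_tanMap_sub_eq hca hca0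
  have hga : -Complex.tan a = (Real.tan α : ℂ) := by
    rw [ha_def]; push_cast; rw [Complex.tan_neg, neg_neg]
  rw [hga] at hg
  set ζ : ℝ → ℂ := fun ε => zeta t (((arcHalfLength σ - ε - Real.pi) / 2 : ℝ) : ℂ) with hζ_def
  have hζ0 : ζ 0 = a := by
    have := zeta_ofReal_sub_mul_tan ht (y := -α) hcos.ge
    rw [hp] at this
    simpa [hζ_def, ha_def] using this
  have hζ : Tendsto ζ (𝓝[>] 0) (𝓝 a) := by
    have : Continuous ζ := (continuous_zeta_ofReal ht).comp (by fun_prop)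
    rw [← hζ0]
    exact (this.tendsto 0).mono_left nhdsWithin_le_nhds
  have hga0 : (Real.tan α : ℂ) ≠ 0 := by exact_mod_cast htan0.ne'
  have hgζ : Tendsto (fun ε => g (ζ ε)) (𝓝[>] 0) (𝓝 (Real.tan α : ℂ)) := hg.comp hζ
  have hsq : Tendsto (fun ε : ℝ => ((ζ ε - a) / (Real.sqrt ε : ℂ)) ^ 2) (𝓝[>] 0)
      (𝓝 (-(κ : ℂ) ^ 2)) := by
    have h5 : -(κ : ℂ) ^ 2 = -(1 / 2) / (Real.tan α : ℂ) := by
      rw [eq_div_iff hga0]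
      have : ((κ ^ 2 * (2 * Real.tan α) : ℝ) : ℂ) = 1 := by rw [hκ2]; simp
      rw [← mul_right_inj' (two_ne_zero : (2 : ℂ) ≠ 0)]
      push_cast at this ⊢
      linear_combination -this
    rw [h5]
    refine ((tendsto_const_nhds (x := (-(1 / 2) : ℂ))).div hgζ hga0).congr' ?_
    filter_upwards [self_mem_nhdsWithin, hζ.eventually hgeq, hgζ.eventually_ne hga0]
      with ε hε h6 h7
    have hε0 : (0 : ℝ) < ε := hε
    have h8 : tanMap t (ζ ε) - tanMap t a = -(ε / 2) := by
      rw [tanMap_zeta ht (by simp), ← hζ0, tanMap_zeta ht (by simp)]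
      push_cast
      ring
    rw [h8] at h6
    simp only [Pi.div_apply]
    have h9 : ((Real.sqrt ε : ℝ) : ℂ) ^ 2 = ε := by
      rw [← Complex.ofReal_pow, Real.sq_sqrt hε0.le]
    have h10 : (ε : ℂ) ≠ 0 := by exact_mod_cast hε0.ne'
    rw [div_pow, h9, div_eq_div_iff h7 h10]
    linear_combination h6
  refine (tendsto_im_of_sq_tendsto hκ ?_ hsq).congr fun ε => ?_
  · refine Eventually.of_forall fun ε => ?_
    rw [Complex.div_ofReal_im]
    refine div_nonneg ?_ (Real.sqrt_nonneg _)
    simpa [ha_def] using im_zeta_ofReal_nonneg ht _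
  · rw [Complex.div_ofReal_im]
    simp [ha_def, hζ_def]

/-- In the critical case the values of `ζ_t` stay in a sector near `0`. -/
lemma eventually_abs_re_le : ∀ᶠ ζ in 𝓝 (0 : ℂ), ζ ∈ tanDomain 1 → |ζ.re| ≤ 4 * ζ.im := by
  have h1 : ∀ᶠ ζ : ℂ in 𝓝 0, Real.cosh ζ.im < 2 := by
    have : Continuous fun ζ : ℂ => Real.cosh ζ.im := by fun_prop
    exact this.continuousAt.eventually_lt continuousAt_const (by simp)
  have h2 : ∀ᶠ ζ : ℂ in 𝓝 0, |ζ.re| < Real.pi / 2 := by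
    have : Continuous fun ζ : ℂ => |ζ.re| := by fun_prop
    exact this.continuousAt.eventually_lt continuousAt_const (by simpa using Real.pi_div_two_pos)
  filter_upwards [h1, h2] with ζ hζ1 hζ2 hζ
  have h3 : 1 ≤ sinhc (2 * ζ.im) := one_le_sinhc (by linarith [hζ.1])
  have h4 := hζ.2
  rw [normSq_cos] at h4
  have h5 : Real.sin ζ.re ^ 2 ≤ Real.sinh ζ.im ^ 2 := by
    nlinarith [Real.sin_sq_add_cos_sq ζ.re]
  have h7 := abs_le_of_sq_le_sq h5 (Real.sinh_nonneg_iff.2 hζ.1)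
  have h8 := sinh_le_mul_cosh hζ.1
  -- The constant `4` comes from `|x|/2 ≤ |sin x| ≤ sinh y ≤ y cosh y ≤ 2y`.
  have h9 := Real.mul_abs_le_abs_sin hζ2.le
  have h10 : 1 / 2 ≤ 2 / Real.pi := by
    rw [div_le_div_iff₀ two_pos Real.pi_pos]
    linarith [Real.pi_le_four]
  nlinarith [abs_nonneg ζ.re, mul_le_mul_of_nonneg_left hζ1.le hζ.1,
    mul_le_mul_of_nonneg_right h10 (abs_nonneg ζ.re)]

/-- For `t = 1` the equation reads `sin ζ - ζ cos ζ = (ε/2) cos ζ`, and the left side is about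
`ζ³/3`, so `ζ³/ε → 3/2`. The sector bound selects the cube root of argument `2π/3`. -/
lemma tendsto_im_zeta_critical :
    Tendsto (fun ε : ℝ => (zeta 1 (((Real.pi - ε - Real.pi) / 2 : ℝ) : ℂ)).im / ε ^ (1 / 3 : ℝ))
      (𝓝[>] 0) (𝓝 ((3 / 2 : ℝ) ^ (1 / 3 : ℝ) * (Real.sqrt 3 / 2))) := by
  have ht : (0 : ℝ) < 1 := one_pos
  set ζ : ℝ → ℂ := fun ε => zeta 1 (((Real.pi - ε - Real.pi) / 2 : ℝ) : ℂ) with hζ_def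
  have hζ0 : ζ 0 = 0 := by
    have := zeta_ofReal_sub_mul_tan ht (y := 0) (by simp)
    simpa [hζ_def] using this
  have hζ : Tendsto ζ (𝓝[>] 0) (𝓝 0) := by
    have : Continuous ζ := (continuous_zeta_ofReal ht).comp (by fun_prop)
    conv => arg 3; rw [← hζ0]
    exact (this.tendsto 0).mono_left nhdsWithin_le_nhds
  have hroot : ∀ x : ℝ, 0 ≤ x → (x ^ (1 / 3 : ℝ)) ^ 3 = x := by
    intro x hx
    have := Real.rpow_inv_natCast_pow hx (n := 3) (by norm_num)
    rwa [show (((3 : ℕ) : ℝ))⁻¹ = 1 / 3 by norm_num] at this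
  have hcube : Tendsto (fun ε : ℝ => (ζ ε / ((ε ^ (1 / 3 : ℝ) : ℝ) : ℂ)) ^ 3) (𝓝[>] 0)
      (𝓝 ((((3 / 2 : ℝ) ^ (1 / 3 : ℝ) : ℝ) : ℂ) ^ 3)) := by
    have h1 : ((((3 / 2 : ℝ) ^ (1 / 3 : ℝ) : ℝ) : ℂ) ^ 3) = (1 / 2) * Complex.cos 0 / (1 / 3) := by
      rw [← Complex.ofReal_pow, hroot _ (by norm_num)]
      norm_num
    rw [h1]
    have h2 : Tendsto (fun ε => sinSubRatio (ζ ε)) (𝓝[>] 0) (𝓝 (1 / 3)) :=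
      tendsto_sinSubRatio.comp hζ
    have h3 : Tendsto (fun ε => Complex.cos (ζ ε)) (𝓝[>] 0) (𝓝 (Complex.cos 0)) :=
      (Complex.continuous_cos.tendsto 0).comp hζ
    refine ((h3.const_mul _).div h2 (by norm_num)).congr' ?_
    filter_upwards [self_mem_nhdsWithin, h2.eventually_ne (by norm_num : (1 / 3 : ℂ) ≠ 0)] with ε hε h4
    have hε0 : (0 : ℝ) < ε := hε
    have hc := cos_ne_zero ht (zeta_mem ht (θ := (((Real.pi - ε - Real.pi) / 2 : ℝ) : ℂ)) (by simp))
    have hF := tanMap_zeta ht (θ := (((Real.pi - ε - Real.pi) / 2 : ℝ) : ℂ)) (by simp)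
    have h5 := pow_three_mul_sinSubRatio (ζ ε)
    change Complex.cos (ζ ε) ≠ 0 at hc
    change tanMap 1 (ζ ε) = _ at hF
    rw [tanMap, Complex.tan_eq_sin_div_cos] at hF
    push_cast at hF
    field_simp at hF
    have h10 : (ε : ℂ) ≠ 0 := by exact_mod_cast hε0.ne'
    rw [div_pow, ← Complex.ofReal_pow, hroot _ hε0.le]
    simp only [Pi.div_apply]
    rw [div_eq_div_iff h4 h10, h5]
    linear_combination (1 / 2) * hF
  refine (tendsto_im_of_cube_tendsto (by positivity) ?_ hcube).congr fun ε => ?_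
  · filter_upwards [self_mem_nhdsWithin, hζ.eventually eventually_abs_re_le] with ε hε h
    have hε0 : (0 : ℝ) < ε := hε
    have h1 := h (zeta_mem ht (by simp))
    have h2 : 0 < ε ^ (1 / 3 : ℝ) := by positivity
    rw [Complex.div_ofReal_im, Complex.div_ofReal_re, abs_div, abs_of_pos h2, ← mul_div_assoc]
    gcongr
  · rw [Complex.div_ofReal_im]

lemma isEquivalent_of_tendsto_div {u v : ℝ → ℝ} {l : Filter ℝ} {c : ℝ} (hc : c ≠ 0)
    (hv : ∀ᶠ x in l, v x ≠ 0) (h : Tendsto (fun x => u x / v x) l (𝓝 c)) :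
    u ~[l] fun x => c * v x := by
  have h1 := ((isEquivalent_const_iff_tendsto hc).2 h).mul (IsEquivalent.refl (u := v) (l := l))
  refine h1.congr_left ?_
  filter_upwards [hv] with x hx
  exact div_mul_cancel₀ _ hx

end FreeUnitaryNormal

end

/-! ### The theorem -/

open FreeUnitaryNormal

theorem mainTheorem3 (σ : ℝ) (hσ : 0 < σ) :
    -- the function `ζ_{σ²/4}` is well defined, and continuous on the closed upper half-plane
    (∀ θ : ℂ, 0 < θ.im → ∃! ζ : ℂ, FreeUnitaryNormal.IsZetaSolution (σ ^ 2 / 4) θ ζ) ∧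
    (∀ θ : ℂ, 0 < θ.im →
      FreeUnitaryNormal.IsZetaSolution (σ ^ 2 / 4) θ (FreeUnitaryNormal.zeta (σ ^ 2 / 4) θ)) ∧
    ContinuousOn (FreeUnitaryNormal.zeta (σ ^ 2 / 4)) {θ : ℂ | 0 ≤ θ.im} ∧
    -- the distribution exists and is unique
    (∃! μ : Measure Circle, FreeUnitaryNormal.IsFreeUnitaryNormal σ μ) ∧
    ∀ μ : Measure Circle, FreeUnitaryNormal.IsFreeUnitaryNormal σ μ →
      ∃ f : Circle → ℝ,
        -- `f` is the continuous density of `μ`, given by the formula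
        Continuous f ∧ (∀ u : Circle, 0 ≤ f u) ∧
        μ = FreeUnitaryNormal.lengthMeasure.withDensity (fun u => ENNReal.ofReal (f u)) ∧
        (∀ θ : ℝ, f (Circle.exp θ) =
          2 / (Real.pi * σ ^ 2) *
            (FreeUnitaryNormal.zeta (σ ^ 2 / 4) (((θ - Real.pi) / 2 : ℝ) : ℂ)).im) ∧
        -- invariance under complex conjugation
        μ.map (fun u : Circle => u⁻¹) = μ ∧
        (∀ θ : ℝ, f (Circle.exp θ) = f (Circle.exp (-θ))) ∧
        -- (a)
        (4 < σ ^ 2 →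
          (∀ θ : ℝ, 0 < f (Circle.exp θ)) ∧
          AnalyticOnNhd ℝ (fun θ : ℝ => f (Circle.exp θ)) univ) ∧
        -- (b)
        (σ ^ 2 < 4 →
          FreeUnitaryNormal.arcHalfLength σ = ∫ t in (0 : ℝ)..σ, Real.sqrt (4 - t ^ 2) ∧
          ContinuousOn (fun θ : ℝ => f (Circle.exp θ)) (Icc (-Real.pi) Real.pi) ∧
          (∀ θ ∈ Ioo (-FreeUnitaryNormal.arcHalfLength σ) (FreeUnitaryNormal.arcHalfLength σ),
            0 < f (Circle.exp θ)) ∧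
          AnalyticOnNhd ℝ (fun θ : ℝ => f (Circle.exp θ))
            (Ioo (-FreeUnitaryNormal.arcHalfLength σ) (FreeUnitaryNormal.arcHalfLength σ)) ∧
          (∀ θ ∈ Icc (-Real.pi) Real.pi \
              Ioo (-FreeUnitaryNormal.arcHalfLength σ) (FreeUnitaryNormal.arcHalfLength σ),
            f (Circle.exp θ) = 0) ∧
          f (Circle.exp (FreeUnitaryNormal.arcHalfLength σ)) = 0 ∧
          f (Circle.exp (-FreeUnitaryNormal.arcHalfLength σ)) = 0 ∧
          (∀ ε : ℝ, f (Circle.exp (FreeUnitaryNormal.arcHalfLength σ - ε)) =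
            f (Circle.exp (ε - FreeUnitaryNormal.arcHalfLength σ))) ∧
          (fun ε : ℝ => f (Circle.exp (FreeUnitaryNormal.arcHalfLength σ - ε))) ~[𝓝[>] 0]
            (fun ε : ℝ => 1 / (Real.pi * σ ^ 2) *
              (4 * σ ^ 2 / (4 - σ ^ 2)) ^ (1 / 4 : ℝ) * Real.sqrt ε)) ∧
        -- (c)
        (σ ^ 2 = 4 →
          (∀ θ ∈ Ioo (-Real.pi) Real.pi, 0 < f (Circle.exp θ)) ∧
          AnalyticOnNhd ℝ (fun θ : ℝ => f (Circle.exp θ)) (Ioo (-Real.pi) Real.pi) ∧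
          f (Circle.exp Real.pi) = 0 ∧
          f (Circle.exp (-Real.pi)) = 0 ∧
          (∀ ε : ℝ, f (Circle.exp (Real.pi - ε)) = f (Circle.exp (ε - Real.pi))) ∧
          (fun ε : ℝ => f (Circle.exp (Real.pi - ε))) ~[𝓝[>] 0]
            (fun ε : ℝ => Real.sqrt 3 / (4 * Real.pi) * (3 * ε / 2) ^ (1 / 3 : ℝ))) := by
  have ht : 0 < σ ^ 2 / 4 := by positivity
  refine ⟨fun θ hθ => existsUnique_isZetaSolution ht hθ, fun θ hθ => isZetaSolution_zeta ht hθ,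
    continuousOn_zeta ht, ⟨_, isFreeUnitaryNormal_normalMeasure hσ,
      fun μ hμ => hμ.eq_normalMeasure hσ⟩, fun μ hμ => ?_⟩
  obtain rfl := hμ.eq_normalMeasure hσ
  have hcont := continuous_density ht
  have hformula : ∀ θ : ℝ, density (σ ^ 2 / 4) (Circle.exp θ) = 2 / (Real.pi * σ ^ 2) *
      (zeta (σ ^ 2 / 4) (((θ - Real.pi) / 2 : ℝ) : ℂ)).im := by
    intro θ
    rw [density_exp ht]
    congr 1
    field_simp
    norm_num
  have hsymm : ∀ θ : ℝ, density (σ ^ 2 / 4) (Circle.exp θ) =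
      density (σ ^ 2 / 4) (Circle.exp (-θ)) := fun θ => (density_exp_neg ht θ).symm
  have hC : 0 < 2 / (Real.pi * σ ^ 2) := by positivity
  have hpos : ∀ θ : ℝ, 0 < (zeta (σ ^ 2 / 4) (((θ - Real.pi) / 2 : ℝ) : ℂ)).im →
      0 < density (σ ^ 2 / 4) (Circle.exp θ) := fun θ h => by
    rw [hformula]; exact mul_pos hC h
  have han : ∀ θ : ℝ, 0 < (zeta (σ ^ 2 / 4) (((θ - Real.pi) / 2 : ℝ) : ℂ)).im →
      AnalyticAt ℝ (fun θ : ℝ => density (σ ^ 2 / 4) (Circle.exp θ)) θ := by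
    intro θ h
    simp only [hformula]
    have h1 : AnalyticAt ℝ (fun θ : ℝ => (θ - Real.pi) / 2) θ := by fun_prop (disch := norm_num)
    exact analyticAt_const.mul ((analyticAt_im_zeta_ofReal ht h).comp_of_eq h1 rfl)
  have hreflect : ∀ a ε : ℝ, density (σ ^ 2 / 4) (Circle.exp (a - ε)) =
      density (σ ^ 2 / 4) (Circle.exp (ε - a)) := fun a ε => by
    rw [hsymm, neg_sub]
  have hzero : σ ≤ 2 → ∀ θ ∈ Icc (-Real.pi) Real.pi \ Ioo (-arcHalfLength σ) (arcHalfLength σ),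
      density (σ ^ 2 / 4) (Circle.exp θ) = 0 := by
    rintro h2 θ ⟨⟨hθ1, hθ2⟩, hθ⟩
    rcases le_or_gt (arcHalfLength σ) θ with h | h
    · rw [hformula, im_zeta_eq_zero_of_mem_Icc hσ h2 ⟨h, hθ2⟩, mul_zero]
    · have h3 : θ ≤ -arcHalfLength σ := by
        by_contra! h4
        exact hθ ⟨h4, h⟩
      -- The negative end of the interval is reflected to the positive one.
      rw [hsymm, hformula, im_zeta_eq_zero_of_mem_Icc hσ h2 ⟨by linarith, by linarith⟩, mul_zero]
  have hedge : σ ≤ 2 → density (σ ^ 2 / 4) (Circle.exp (arcHalfLength σ)) = 0 := fun h2 => by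
    have h3 := arcHalfLength_le_pi hσ h2
    have h4 := arcHalfLength_pos hσ
    exact hzero h2 _ ⟨⟨by linarith [Real.pi_pos], h3⟩, fun h => lt_irrefl _ h.2⟩
  refine ⟨density (σ ^ 2 / 4), hcont, density_nonneg ht, rfl, hformula, map_inv_normalMeasure ht,
    hsymm, fun hσ4 => ?_, fun hσ4 => ?_, fun hσ4 => ?_⟩
  · have h1 : ∀ θ : ℝ, 0 < (zeta (σ ^ 2 / 4) (((θ - Real.pi) / 2 : ℝ) : ℂ)).im :=
      fun θ => im_zeta_ofReal_pos_of_one_lt (by linarith) _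
    exact ⟨fun θ => hpos θ (h1 θ), fun θ _ => han θ (h1 θ)⟩
  · have hσ2 : σ < 2 := by nlinarith
    have h1 := fun θ hθ => im_zeta_pos_of_mem_Ioo hσ hσ2.le (θ := θ) hθ
    refine ⟨arcHalfLength_eq_integral hσ hσ2, (hcont.comp Circle.exp.continuous).continuousOn,
      fun θ hθ => hpos θ (h1 θ hθ), fun θ hθ => han θ (h1 θ hθ), hzero hσ2.le, hedge hσ2.le,
      by rw [← hsymm]; exact hedge hσ2.le, hreflect _, ?_⟩
    have h4 : 0 < 4 - σ ^ 2 := by linarith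
    have h2 := (tendsto_im_zeta_edge hσ hσ2).const_mul (2 / (Real.pi * σ ^ 2))
    have h3 := isEquivalent_of_tendsto_div
      (u := fun ε => density (σ ^ 2 / 4) (Circle.exp (arcHalfLength σ - ε)))
      (v := Real.sqrt) (l := 𝓝[>] 0) ?_ ?_ (h2.congr fun ε => ?_)
    · refine h3.congr_right (Eventually.of_forall fun ε => ?_)
      simp only
      ring
    · positivity
    · filter_upwards [self_mem_nhdsWithin] with ε hε
      exact (Real.sqrt_pos.2 hε).ne'
    · rw [hformula, mul_div_assoc]
  · have hσ2 : σ = 2 := by nlinarith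
    have hm : arcHalfLength σ = Real.pi := by
      rw [hσ2, arcHalfLength]
      norm_num
      ring
    have h1 := fun θ hθ => im_zeta_pos_of_mem_Ioo hσ hσ2.le (θ := θ) hθ
    have hedge' := hedge hσ2.le
    rw [hm] at h1 hedge'
    refine ⟨fun θ hθ => hpos θ (h1 θ hθ), fun θ hθ => han θ (h1 θ hθ), hedge',
      by rw [← hsymm]; exact hedge', hreflect _, ?_⟩
    have h2 := tendsto_im_zeta_critical.const_mul (2 / (Real.pi * σ ^ 2))
    have h3 := isEquivalent_of_tendsto_div
      (u := fun ε => density (σ ^ 2 / 4) (Circle.exp (Real.pi - ε)))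
      (v := fun ε => ε ^ (1 / 3 : ℝ)) (l := 𝓝[>] 0) ?_ ?_ (h2.congr fun ε => ?_)
    · refine h3.congr_right ?_
      filter_upwards [self_mem_nhdsWithin] with ε hε
      have hε0 : (0 : ℝ) < ε := hε
      rw [show 3 * ε / 2 = 3 / 2 * ε by ring, Real.mul_rpow (by norm_num) hε0.le, hσ4]
      field_simp
    · positivity
    · filter_upwards [self_mem_nhdsWithin] with ε hε
      have hε0 : (0 : ℝ) < ε := hε
      positivity
    · rw [hformula, mul_div_assoc, hσ4, div_self (by norm_num : (4 : ℝ) ≠ 0)]
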